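/- Let $M$ be a smooth 4-dimensional manifold (Hausdorff, second countable) with a smooth Lorentz metric $g$ of signature $(1,3)$ and a smooth affine connection $D$ that is compatible with $g$, with arbitrary torsion $T(X,Y)=D_XY-D_YX-[X,Y]$ (a Riemann–Cartan spacetime; orientations play no role). Put $\eta=\mathrm{diag}(1,-1,-1,-1)$. Let $\gamma:I\to M$ be a timelike autoparallel line: $I\subset\mathbb R$ is an interval, $\gamma$ is smooth (on a neighbourhood of $I$, if $I$ contains an end point), $g(\gamma_*,\gamma_*)>0$ and $D_{\gamma_*}\gamma_*=0$ on $I$, and $\gamma$ is a homeomorphism of $I$ onto its image $\gamma(I)\subset M$. Call a smooth frame $(e_0,e_1,e_2,e_3)$ on an open neighbourhood $U$ of $\gamma(I)$ an *inertial moving frame along $\gamma$* if it is a section of the orthonormal frame bundle over $U$, i.e. $g(e_\mu,e_\nu)=\eta_{\mu\nu}$ on $U$ (in particular on $\gamma$), and at every point of $\gamma$ $$e_0=\frac{1}{\sqrt{g(\gamma_*,\gamma_*)}}\,\gamma_*,\qquad \Gamma^{\mu}_{\ \nu\rho}=0\quad\text{for all }\mu,\nu,\rho,$$ where $D_{e_\nu}e_\rho=\Gamma^{\mu}_{\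 \nu\rho}e_\mu$. Then: 1. There exists an inertial moving frame along $\gamma$. 2. For every inertial moving frame along $\gamma$, with structure coefficients $c^{\beta}_{\ \mu\nu}$ given by $[e_\mu,e_\nu]=c^{\beta}_{\ \mu\nu}e_\beta$ on $U$, one has $c^{\beta}_{\ \mu\nu}=-T^{\beta}_{\ \mu\nu}$ at every point of $\gamma$, where $T^\beta_{\ \mu\nu}$ are the components of the torsion in the frame. Hence at a point $p\in\gamma$ the $c^{\beta}_{\ \mu\nu}$ are not all zero if and only if $T_p\neq0$; and if $T_p\neq 0$, then $(e_\mu)$ is not the coordinate basis of any chart around $p$. -/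

import Mathlib

open scoped Manifold ContDiff

noncomputable section

/-- Four-dimensional model space. -/
abbrev R4 : Type := EuclideanSpace ℝ (Fin 4)

/-- The Minkowski matrix `diag(1, -1, -1, -1)`. -/
def minkowskiEta : Matrix (Fin 4) (Fin 4) ℝ := Matrix.diagonal ![1, -1, -1, -1]

/-- A smooth Lorentz metric of signature `(1, 3)` on a 4-manifold: a smooth symmetric
`(0,2)`-tensor field for which every tangent space has a basis with Gram matrix
`diag(1, -1, -1, -1)`. -/
structure LorentzMetric (M : Type*) [TopologicalSpace M] [ChartedSpace R4 M]
    [IsManifold (𝓡 4) ∞ M] where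
  /-- The bilinear form on each tangent space. -/
  val (x : M) : TangentSpace (𝓡 4) x →L[ℝ] TangentSpace (𝓡 4) x →L[ℝ] ℝ
  symm (x : M) (v w : TangentSpace (𝓡 4) x) : val x v w = val x w v
  signature (x : M) : ∃ b : Module.Basis (Fin 4) ℝ (TangentSpace (𝓡 4) x),
    ∀ μ ν, val x (b μ) (b ν) = minkowskiEta μ ν
  contMDiff : ContMDiff (𝓡 4) ((𝓡 4).prod 𝓘(ℝ, R4 →L[ℝ] R4 →L[ℝ] ℝ)) ∞
    (fun x ↦ Bundle.TotalSpace.mk' (R4 →L[ℝ] R4 →L[ℝ] ℝ)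
      (E := fun x : M ↦ TangentSpace (𝓡 4) x →L[ℝ] TangentSpace (𝓡 4) x →L[ℝ] ℝ) x (val x))

/-- A Riemann–Cartan structure on a 4-manifold: a Lorentz metric `g` together with a smooth
affine connection `D` (`D Y x v` is `(D_v Y)(x)`) that is compatible with `g`;
its torsion is arbitrary. -/
structure RiemannCartan (M : Type*) [TopologicalSpace M] [ChartedSpace R4 M]
    [IsManifold (𝓡 4) ∞ M] where
  /-- The metric. -/
  g : LorentzMetric M
  /-- The connection. -/
  D : CovariantDerivative (𝓡 4) R4 (TangentSpace (𝓡 4) : M → Type _)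
  smooth : D.ContMDiffCovariantDerivative ∞
  /-- `v (g(X, Y)) = g(D_v X, Y) + g(X, D_v Y)`. -/
  compatible (X Y : ∀ x : M, TangentSpace (𝓡 4) x) (x : M)
    (hX : MDifferentiableAt (𝓡 4) (𝓡 4).tangent (fun y ↦ (⟨y, X y⟩ : TangentBundle (𝓡 4) M)) x)
    (hY : MDifferentiableAt (𝓡 4) (𝓡 4).tangent (fun y ↦ (⟨y, Y y⟩ : TangentBundle (𝓡 4) M)) x)
    (v : TangentSpace (𝓡 4) x) :
    mvfderiv (𝓡 4) (fun y ↦ g.val y (X y) (Y y)) x v =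
      g.val x (D X x v) (Y x) + g.val x (X x) (D Y x v)

/-- The tangent vector `γ_*` of a curve at parameter `t`. -/
def curveVelocity {M : Type*} [TopologicalSpace M] [ChartedSpace R4 M]
    (γ : ℝ → M) (t : ℝ) : TangentSpace (𝓡 4) (γ t) :=
  mfderiv 𝓘(ℝ, ℝ) (𝓡 4) γ t (1 : ℝ)

/-- Covariant derivative `D_{γ_*} V` at parameter `t` of a vector field `V` along the curve `γ`:
writing `V = ∑ V^i ∂_i` in the coordinate frame of the preferred chart at `γ t`,
it is `∑ (dV^i/dt) ∂_i + V^i D_{γ_*} ∂_i`. -/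
def covDerivAlong {M : Type*} [TopologicalSpace M] [ChartedSpace R4 M] [IsManifold (𝓡 4) ∞ M]
    (D : CovariantDerivative (𝓡 4) R4 (TangentSpace (𝓡 4) : M → Type _))
    (γ : ℝ → M) (V : ∀ t, TangentSpace (𝓡 4) (γ t)) (t : ℝ) : TangentSpace (𝓡 4) (γ t) :=
  let e := trivializationAt R4 (TangentSpace (𝓡 4) : M → Type _) (γ t)
  let b := (EuclideanSpace.basisFun (Fin 4) ℝ).toBasis
  ∑ i, (deriv (fun s ↦ e.localFrameCoeff (𝓡 4) b i (γ s) (V s)) t • e.localFrame b i (γ t)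
    + e.localFrameCoeff (𝓡 4) b i (γ t) (V t) •
        D (e.localFrame b i) (γ t) (curveVelocity γ t))

/-- A family `e = (e_0, e_1, e_2, e_3)` of vector fields is a coordinate basis near `x` if, for
some smooth chart `φ` around `x` (with arbitrarily small domain), `e_μ = ∂/∂φ^μ` on the domain of
`φ`, that is `dφ(e_μ)` is the `μ`-th standard basis vector. -/
def IsCoordinateBasisNear {M : Type*} [TopologicalSpace M] [ChartedSpace R4 M]
    (e : Fin 4 → ∀ x : M, TangentSpace (𝓡 4) x) (x : M) : Prop :=
  ∃ φ ∈ IsManifold.maximalAtlas (𝓡 4) ∞ M, x ∈ φ.source ∧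
    ∀ y ∈ φ.source, ∀ μ,
      mfderiv (𝓡 4) (𝓡 4) φ y (e μ y) = (EuclideanSpace.single μ (1 : ℝ) : R4)

namespace RiemannCartan

variable {M : Type*} [TopologicalSpace M] [ChartedSpace R4 M] [IsManifold (𝓡 4) ∞ M]

/-- `γ`, parametrized by the interval `I` (open, closed or half-open), is a timelike autoparallel:
it is smooth on a neighbourhood of `I`, and on `I` one has `g(γ_*, γ_*) > 0` and
`D_{γ_*} γ_* = 0`. -/
structure IsTimelikeAutoparallel (S : RiemannCartan M) (γ : ℝ → M) (I : Set ℝ) : Prop where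
  ordConnected : I.OrdConnected
  smooth : ∃ J : Set ℝ, IsOpen J ∧ I ⊆ J ∧ ContMDiffOn 𝓘(ℝ, ℝ) (𝓡 4) ∞ γ J
  timelike : ∀ t ∈ I, 0 < S.g.val (γ t) (curveVelocity γ t) (curveVelocity γ t)
  autoparallel : ∀ t ∈ I, covDerivAlong S.D γ (curveVelocity γ) t = 0

/-- `e` is a smooth section over the open set `U` of the bundle of orthonormal frames. -/
structure IsOrthonormalFrameOn (S : RiemannCartan M) (U : Set M)
    (e : Fin 4 → ∀ x : M, TangentSpace (𝓡 4) x) : Prop where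
  isOpen : IsOpen U
  frame : IsLocalFrameOn (𝓡 4) R4 ∞ e U
  orthonormal : ∀ x ∈ U, ∀ μ ν, S.g.val x (e μ x) (e ν x) = minkowskiEta μ ν

variable {S : RiemannCartan M} {U : Set M} {e : Fin 4 → ∀ x : M, TangentSpace (𝓡 4) x}

/-- Connection coefficients `Γ^μ_{νρ}` of the frame: `D_{e_ν} e_ρ = Γ^μ_{νρ} e_μ`. -/
def IsOrthonormalFrameOn.connectionCoeff (h : S.IsOrthonormalFrameOn U e)
    (μ ν ρ : Fin 4) (x : M) : ℝ :=
  h.frame.coeff μ x (S.D (e ρ) x (e ν x))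

/-- Structure coefficients `c^β_{μν}` of the frame: `[e_μ, e_ν] = c^β_{μν} e_β`. -/
def IsOrthonormalFrameOn.structureCoeff (h : S.IsOrthonormalFrameOn U e)
    (β μ ν : Fin 4) (x : M) : ℝ :=
  h.frame.coeff β x (VectorField.mlieBracket (𝓡 4) (e μ) (e ν) x)

/-- Components `T^β_{μν}` of the torsion tensor in the frame. -/
def IsOrthonormalFrameOn.torsionCoeff (h : S.IsOrthonormalFrameOn U e)
    (β μ ν : Fin 4) (x : M) : ℝ :=
  h.frame.coeff β x (S.D.torsion x (e μ x) (e ν x))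

/-- `e`, defined over the neighbourhood `U` of `γ(I)`, is an inertial moving frame along `γ`:
a section of the orthonormal frame bundle over `U` whose `e_0` is the normalised tangent of `γ`
along `γ`, and whose connection coefficients all vanish along `γ`. -/
structure IsInertialMovingFrame (S : RiemannCartan M) (γ : ℝ → M) (I : Set ℝ) (U : Set M)
    (e : Fin 4 → ∀ x : M, TangentSpace (𝓡 4) x) : Prop where
  isOrthonormalFrameOn : S.IsOrthonormalFrameOn U e
  subset : γ '' I ⊆ U
  tangent : ∀ t ∈ I, e 0 (γ t) =
    (1 / √(S.g.val (γ t) (curveVelocity γ t) (curveVelocity γ t))) • curveVelocity γ t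
  connectionCoeff_eq_zero : ∀ t ∈ I, ∀ μ ν ρ,
    isOrthonormalFrameOn.connectionCoeff μ ν ρ (γ t) = 0

end RiemannCartan

end

/-! Existence is a statement about first-order jets along the curve, so torsion does not obstruct
it. In a chart, `D X = 0` at a point prescribes the full differential of the components of `X` in
terms of their values. Along an immersed curve only the tangential part of this is a constraint,
namely parallel transport; the transversal derivatives are free. Hence a parallel field along `γ`
extends locally to a smooth field with `D X = 0` at the points of `γ`, in all directions
(`exists_parallel_extension`, `exists_local_parallel_field`).

By compatibility with `g`, parallel transport preserves inner products, and the velocity of an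
autoparallel is itself parallel. An orthonormal basis with first vector the unit tangent is
therefore transported to a frame with the required values on `γ` (`exists_parallel_frame`). The
local extensions are glued by a partition of unity: their values agree on `γ`, so the terms with
derivatives of the weights cancel (`exists_fields_extending`). The result is orthonormal only on
`γ`, but its Gram matrix has zero differential there, so Gram–Schmidt uses coefficients that are
constant to first order on `γ` and keeps both the values and `D = 0` (`IsAdapted.exists_succ`).

The structure coefficients come from `T(X, Y) = D_X Y - D_Y X - [X, Y]`, where both derivatives
vanish on `γ`. Coordinate fields commute, which excludes a coordinate basis wherever the torsion is
nonzero. -/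

/-! ### Linear equations and first-order extension along a curve in a vector space -/

section Analysis

open Filter Topology Set

variable {E : Type*} [NormedAddCommGroup E] [NormedSpace ℝ E] [CompleteSpace E]

/-- Local existence of a smooth fundamental solution of the linear equation `Φ' = A Φ`. -/
lemma exists_local_fundamental_solution {A : ℝ → E →L[ℝ] E} {t₀ : ℝ}
    (hA : ∀ᶠ t in 𝓝 t₀, ContDiffAt ℝ ∞ A t) :
    ∃ Φ : ℝ → E →L[ℝ] E, Φ t₀ = ContinuousLinearMap.id ℝ E ∧
      ∀ᶠ t in 𝓝 t₀, ContDiffAt ℝ ∞ Φ t ∧ HasDerivAt Φ ((A t).comp (Φ t)) t := by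
  -- Time is adjoined as a state variable to make the equation autonomous; `hfst` recovers that this
  -- variable equals `t`.
  let v : ℝ × (E →L[ℝ] E) → ℝ × (E →L[ℝ] E) := fun p ↦ (1, (A p.1).comp p.2)
  have hv : ContDiffAt ℝ 1 v (t₀, ContinuousLinearMap.id ℝ E) := by
    have h1 : ContDiffAt ℝ 1 (fun p : ℝ × (E →L[ℝ] E) ↦ A p.1) (t₀, ContinuousLinearMap.id ℝ E) :=
      (hA.self_of_nhds.of_le (by simp)).comp (f := Prod.fst)
        (t₀, ContinuousLinearMap.id ℝ E) contDiffAt_fst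
    exact contDiffAt_const.prodMk (h1.clm_comp contDiffAt_snd)
  obtain ⟨α, hα₀, ε, hε, hα⟩ :=
    hv.exists_forall_mem_closedBall_exists_eq_forall_mem_Ioo_hasDerivAt₀ t₀
  have hfst : ∀ t ∈ Ioo (t₀ - ε) (t₀ + ε), (α t).1 = t := by
    have h1 : ∀ t ∈ Ioo (t₀ - ε) (t₀ + ε), HasDerivAt (fun t ↦ (α t).1 - t) 0 t := fun t ht ↦ by
      have h := (hasFDerivAt_fst.comp_hasDerivAt t (hα t ht)).sub (hasDerivAt_id t)
      simp only [v, ContinuousLinearMap.coe_fst', sub_self] at h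
      exact h
    intro t ht
    have h2 := (convex_Ioo (t₀ - ε) (t₀ + ε)).is_const_of_fderivWithin_eq_zero (𝕜 := ℝ)
      (f := fun t ↦ (α t).1 - t)
      (fun s hs ↦ (h1 s hs).differentiableAt.differentiableWithinAt)
      (fun s hs ↦ by
        rw [fderivWithin_of_isOpen isOpen_Ioo hs]
        ext; simpa using (h1 s hs).deriv) ht (y := t₀) ⟨by linarith, by linarith⟩
    simp only [hα₀, sub_self] at h2
    linarith
  have hder : ∀ t ∈ Ioo (t₀ - ε) (t₀ + ε),
      HasDerivAt (fun t ↦ (α t).2) ((A t).comp (α t).2) t := fun t ht ↦ by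
    have := hasFDerivAt_snd.comp_hasDerivAt t (hα t ht)
    simp only [v, hfst t ht, ContinuousLinearMap.coe_snd'] at this
    exact this
  refine ⟨fun t ↦ (α t).2, by simp [hα₀], ?_⟩
  have hmem : Ioo (t₀ - ε) (t₀ + ε) ∈ 𝓝 t₀ := Ioo_mem_nhds (by linarith) (by linarith)
  have hboth : ∀ᶠ t in 𝓝 t₀, t ∈ Ioo (t₀ - ε) (t₀ + ε) ∧ ContDiffAt ℝ ∞ A t :=
    hA.and hmem |>.mono fun t h ↦ ⟨h.2, h.1⟩
  obtain ⟨δ, hδ, hball⟩ := Metric.eventually_nhds_iff.1 hboth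
  have hsub : ∀ t ∈ Icc (t₀ - δ / 2) (t₀ + δ / 2),
      t ∈ Ioo (t₀ - ε) (t₀ + ε) ∧ ContDiffAt ℝ ∞ A t := fun t ht ↦ hball (by
    rw [Real.dist_eq, abs_lt]; constructor <;> linarith [ht.1, ht.2])
  have hsm : ContDiffOn ℝ (⊤ : ℕ∞) (fun t ↦ (α t).2) (Icc (t₀ - δ / 2) (t₀ + δ / 2)) := by
    refine ODE.contDiffOn_enat_Icc_of_hasDerivWithinAt (u := univ)
      (f := fun t (Φ : E →L[ℝ] E) ↦ (A t).comp Φ) ?_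
      (fun t ht ↦ (hder t (hsub t ht).1).hasDerivWithinAt) (fun _ _ ↦ mem_univ _)
    rintro ⟨t, Φ⟩ ⟨ht, -⟩
    have h1 : ContDiffAt ℝ ∞ (fun p : ℝ × (E →L[ℝ] E) ↦ A p.1) (t, Φ) :=
      (hsub t ht).2.comp (f := Prod.fst) (t, Φ) contDiffAt_fst
    exact (h1.clm_comp contDiffAt_snd).contDiffWithinAt
  filter_upwards [Ioo_mem_nhds (show t₀ - δ / 2 < t₀ by linarith)
    (show t₀ < t₀ + δ / 2 by linarith)] with t ht
  exact ⟨hsm.contDiffAt (Icc_mem_nhds ht.1 ht.2), hder t (hsub t (Ioo_subset_Icc_self ht)).1⟩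

omit [CompleteSpace E] in
/-- Near a point where its velocity does not vanish, a smooth curve has a smooth left inverse. -/
lemma exists_left_inverse_of_deriv_ne_zero {c : ℝ → E} {t₀ : ℝ}
    (hc : ∀ᶠ t in 𝓝 t₀, ContDiffAt ℝ ∞ c t) (hc' : deriv c t₀ ≠ 0) :
    ∃ τ : E → ℝ, (∀ᶠ x in 𝓝 (c t₀), ContDiffAt ℝ ∞ τ x) ∧ ∀ᶠ t in 𝓝 t₀, τ (c t) = t := by
  -- A functional that does not kill the velocity reduces the claim to the inverse function theorem
  -- on `ℝ`.
  obtain ⟨l, hl⟩ := SeparatingDual.exists_ne_zero (R := ℝ) hc'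
  let h : ℝ → ℝ := fun t ↦ l (c t)
  have hh : ∀ᶠ t in 𝓝 t₀, ContDiffAt ℝ ∞ h t := hc.mono fun t ht ↦
    l.contDiff.contDiffAt.comp t ht
  have hd : ∀ᶠ t in 𝓝 t₀, HasDerivAt h (l (deriv c t)) t := hc.mono fun t ht ↦
    l.hasFDerivAt.comp_hasDerivAt t (ht.differentiableAt (by simp)).hasDerivAt
  have hcont : ContinuousAt (fun t ↦ l (deriv c t)) t₀ :=
    l.continuous.continuousAt.comp (hc.self_of_nhds.derivWithin (m := 0) (by simp)).continuousAt
  have hne : ∀ᶠ t in 𝓝 t₀, l (deriv c t) ≠ 0 := hcont.eventually_ne hl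
  let f := hh.self_of_nhds.toOpenPartialHomeomorph h (hd.self_of_nhds.hasFDerivAt_equiv hl)
    (by simp)
  have hsrc : t₀ ∈ f.source := ContDiffAt.mem_toOpenPartialHomeomorph_source _ _ _
  have htgt : h t₀ ∈ f.target := f.map_source hsrc
  have hinv : f.symm (h t₀) = t₀ := f.left_inv hsrc
  have hsymm : ∀ᶠ y in 𝓝 (h t₀), ContDiffAt ℝ ∞ f.symm y := by
    have h1 : Tendsto f.symm (𝓝 (h t₀)) (𝓝 t₀) := by
      simpa [hinv] using (f.continuousAt_symm htgt).tendsto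
    filter_upwards [h1.eventually hh, h1.eventually hd, h1.eventually hne,
      f.open_target.mem_nhds htgt] with y h1 h2 h3 h4
    exact f.contDiffAt_symm_deriv h3 h4 h2 h1
  refine ⟨fun x ↦ f.symm (l x), ?_, ?_⟩
  · have := l.continuous.continuousAt (x := c t₀)
    filter_upwards [this.eventually hsymm] with x hx
    exact hx.comp x l.contDiff.contDiffAt
  · filter_upwards [f.open_source.mem_nhds hsrc] with t ht
    exact f.left_inv ht

/-- A parallel transport equation along a smooth immersed curve extends to a smooth solution near
the curve whose derivatives in all directions are prescribed by the connection along the curve. -/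
lemma exists_parallel_extension {c : ℝ → E} {t₀ : ℝ} {Ω : E → E →L[ℝ] E →L[ℝ] E}
    (hc : ∀ᶠ t in 𝓝 t₀, ContDiffAt ℝ ∞ c t) (hc' : deriv c t₀ ≠ 0)
    (hΩ : ∀ᶠ x in 𝓝 (c t₀), ContDiffAt ℝ ∞ Ω x) :
    ∃ Y : E → E →L[ℝ] E, Y (c t₀) = ContinuousLinearMap.id ℝ E ∧
      (∀ᶠ x in 𝓝 (c t₀), ContDiffAt ℝ ∞ Y x) ∧
      ∀ᶠ t in 𝓝 t₀, ∀ w v, fderiv ℝ Y (c t) w v = -Ω (c t) w (Y (c t) v) := by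
  obtain ⟨τ, hτ, hτc⟩ := exists_left_inverse_of_deriv_ne_zero hc hc'
  have hct : Tendsto c (𝓝 t₀) (𝓝 (c t₀)) := hc.self_of_nhds.continuousAt
  have hdc : ∀ᶠ t in 𝓝 t₀, ContDiffAt ℝ ∞ (deriv c) t :=
    hc.mono fun t ht ↦ ht.derivWithin (by simp)
  have hA : ∀ᶠ t in 𝓝 t₀, ContDiffAt ℝ ∞ (fun t ↦ -Ω (c t) (deriv c t)) t := by
    filter_upwards [hc, hdc, hct.eventually hΩ] with t h1 h2 h3
    exact ((h3.comp t h1).clm_apply h2).neg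
  obtain ⟨Φ, hΦ₀, hΦ⟩ := exists_local_fundamental_solution hA
  -- `B t` is the total derivative that `Y` must have at `c t`.
  let B : ℝ → E →L[ℝ] E →L[ℝ] E := fun t ↦
    -((ContinuousLinearMap.compL ℝ E E E).flip (Φ t)).comp (Ω (c t))
  have hB : ∀ᶠ t in 𝓝 t₀, ContDiffAt ℝ ∞ B t := by
    filter_upwards [hc, hΦ, hct.eventually hΩ] with t h1 h2 h3
    exact ((((ContinuousLinearMap.compL ℝ E E E).flip.contDiff.contDiffAt.comp t h2.1)).clm_comp
      (h3.comp t h1)).neg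
  have hBa : ∀ t w v, B t w v = -Ω (c t) w (Φ t v) := fun t w v ↦ by simp [B]
  have hτ₀ : Tendsto τ (𝓝 (c t₀)) (𝓝 t₀) := by
    simpa [hτc.self_of_nhds] using hτ.self_of_nhds.continuousAt.tendsto
  -- A first-order Taylor expansion around the curve, with `τ x` as foot point. At `c t` its
  -- differential is `w ↦ Φ'(t) dτ(w) + B t (w - dτ(w) c'(t))`, and the transport equation `Φ' = B
  -- c'` reduces this to `B t w`.
  refine ⟨fun x ↦ Φ (τ x) + B (τ x) (x - c (τ x)), ?_, ?_, ?_⟩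
  · simp [hτc.self_of_nhds, hΦ₀]
  · filter_upwards [hτ, hτ₀.eventually hΦ, hτ₀.eventually hB, hτ₀.eventually hc] with x h1 h2 h3 h4
    exact (h2.1.comp x h1).add ((h3.comp x h1).clm_apply (contDiffAt_id.sub (h4.comp x h1)))
  · filter_upwards [hτc, hct.eventually hτ, hΦ, hB, hc] with t h0 h1 h2 h3 h4 w v
    have d1 : HasFDerivAt τ (fderiv ℝ τ (c t)) (c t) := (h1.differentiableAt (by simp)).hasFDerivAt
    have key : ∀ {F : Type _} [NormedAddCommGroup F] [NormedSpace ℝ F] {f : ℝ → F} {f' : F},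
        HasDerivAt f f' t → HasFDerivAt (fun x ↦ f (τ x))
          ((ContinuousLinearMap.toSpanSingleton ℝ f').comp (fderiv ℝ τ (c t))) (c t) :=
      fun {F _ _ f f'} hf ↦ HasFDerivAt.comp (c t) (g := f) (by rw [h0]; exact hf.hasFDerivAt) d1
    have dΦ := key h2.2
    have dB := key (h3.differentiableAt (by simp)).hasDerivAt
    have dc := key (h4.differentiableAt (by simp)).hasDerivAt
    have d := dΦ.add (dB.clm_apply ((hasFDerivAt_id (c t)).sub dc))
    have d' : HasFDerivAt (fun x ↦ Φ (τ x) + B (τ x) (x - c (τ x))) _ (c t) := d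
    rw [d'.fderiv]
    simp [h0, hBa]

end Analysis

lemma contDiffAt_sum_smul_const {E F ι : Type*} [NormedAddCommGroup E] [NormedSpace ℝ E]
    [NormedAddCommGroup F] [NormedSpace ℝ F] [Fintype ι]
    {κ : ι → E → ℝ} {p : E} (hκ : ∀ i, ContDiffAt ℝ ∞ (κ i) p) (C : ι → F) :
    ContDiffAt ℝ ∞ (fun p ↦ ∑ i, κ i p • C i) p :=
  ContDiffAt.sum fun i _ ↦ (hκ i).smul contDiffAt_const

/-! ### Leibniz rule, metric compatibility and derivatives along curves -/

section ManifoldBasics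

open Filter Topology Set

variable {M : Type*} [TopologicalSpace M] [ChartedSpace R4 M]

lemma hasDerivAt_comp_curve {f : M → ℝ} {γ : ℝ → M} {t : ℝ}
    (hf : MDifferentiableAt (𝓡 4) 𝓘(ℝ, ℝ) f (γ t))
    (hγ : MDifferentiableAt 𝓘(ℝ, ℝ) (𝓡 4) γ t) :
    HasDerivAt (fun s ↦ f (γ s)) (mvfderiv (𝓡 4) f (γ t) (curveVelocity γ t)) t := by
  have h1 : HasMFDerivAt 𝓘(ℝ, ℝ) 𝓘(ℝ, ℝ) (f ∘ γ) t _ := hf.hasMFDerivAt.comp t hγ.hasMFDerivAt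
  let A : ℝ →L[ℝ] ℝ := (mfderiv (𝓡 4) 𝓘(ℝ, ℝ) f (γ t)).comp (mfderiv 𝓘(ℝ, ℝ) (𝓡 4) γ t)
  have h2 : HasFDerivAt (f ∘ γ) A t := hasMFDerivAt_iff_hasFDerivAt.1 h1
  exact h2.hasDerivAt

variable [IsManifold (𝓡 4) ∞ M]

/-- The vector field `X` is smooth at `x`. -/
abbrev FieldSmoothAt (X : ∀ x : M, TangentSpace (𝓡 4) x) (x : M) : Prop :=
  ContMDiffAt (𝓡 4) (𝓡 4).tangent ∞ (fun y ↦ (⟨y, X y⟩ : TangentBundle (𝓡 4) M)) x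

/-- The vector field `X` is differentiable at `x`. -/
abbrev FieldMDiffAt (X : ∀ x : M, TangentSpace (𝓡 4) x) (x : M) : Prop :=
  MDifferentiableAt (𝓡 4) (𝓡 4).tangent (fun y ↦ (⟨y, X y⟩ : TangentBundle (𝓡 4) M)) x

/-- The function `f` is smooth at `x`. -/
abbrev SmoothFunAt (f : M → ℝ) (x : M) : Prop := ContMDiffAt (𝓡 4) 𝓘(ℝ, ℝ) ∞ f x

lemma CovariantDerivative.sum_smul_apply
    (D : CovariantDerivative (𝓡 4) R4 (TangentSpace (𝓡 4) : M → Type _)) {ι : Type*}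
    (F : Finset ι) {f : ι → M → ℝ} {X : ι → ∀ x : M, TangentSpace (𝓡 4) x} {x : M}
    (hf : ∀ i ∈ F, MDifferentiableAt (𝓡 4) 𝓘(ℝ, ℝ) (f i) x) (hX : ∀ i ∈ F, FieldMDiffAt (X i) x)
    (v : TangentSpace (𝓡 4) x) :
    D (fun y ↦ ∑ i ∈ F, f i y • X i y) x v =
      ∑ i ∈ F, (f i x • D (X i) x v + mvfderiv (𝓡 4) (f i) x v • X i x) := by
  classical
  induction F using Finset.induction_on with
  | empty =>
    simp only [Finset.sum_empty]
    exact congrArg (fun A ↦ A x v) D.zero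
  | insert a F ha ih =>
    have h1 : FieldMDiffAt (f a • X a) x :=
      (hf a (by simp)).smul_section (hX a (by simp))
    have h2 : FieldMDiffAt (fun y ↦ ∑ i ∈ F, f i y • X i y) x :=
      MDifferentiableAt.sum_section fun i hi ↦
        (hf i (by simp [hi])).smul_section (hX i (by simp [hi]))
    have h3 := D.isCovariantDerivativeOnUniv.add h1 h2 (mem_univ x)
    have h4 := D.isCovariantDerivativeOnUniv.leibniz (hX a (by simp)) (hf a (by simp)) (mem_univ x)
    rw [show (fun y ↦ ∑ i ∈ insert a F, f i y • X i y) =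
      f a • X a + fun y ↦ ∑ i ∈ F, f i y • X i y from funext fun y ↦ by
        simp [Finset.sum_insert ha]]
    rw [h3, h4, Finset.sum_insert ha, ← ih (fun i hi ↦ hf i (by simp [hi]))
      (fun i hi ↦ hX i (by simp [hi]))]
    simp

lemma CovariantDerivative.congr_of_eventuallyEq
    (D : CovariantDerivative (𝓡 4) R4 (TangentSpace (𝓡 4) : M → Type _))
    {X Y : ∀ x : M, TangentSpace (𝓡 4) x} {x : M} (hX : FieldMDiffAt X x)
    (h : ∀ᶠ y in 𝓝 x, X y = Y y) : D X x = D Y x :=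
  D.isCovariantDerivativeOnUniv.congr_of_eventuallyEq hX
    (hX.congr_of_eventuallyEq (h.mono fun y hy ↦ by simp [hy])) univ_mem h

lemma RiemannCartan.contMDiffAt_metric (S : RiemannCartan M)
    {X Y : ∀ x : M, TangentSpace (𝓡 4) x} {x : M}
    (hX : FieldSmoothAt X x) (hY : FieldSmoothAt Y x) :
    SmoothFunAt (fun y ↦ S.g.val y (X y) (Y y)) x := by
  have h1 : ContMDiffAt (𝓡 4) ((𝓡 4).prod 𝓘(ℝ, ℝ)) ∞
      (fun y ↦ Bundle.TotalSpace.mk' ℝ (E := Bundle.Trivial M ℝ) y (S.g.val y (X y) (Y y))) x :=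
    ContMDiffAt.clm_bundle_apply₂ (F₁ := R4) (F₂ := R4) (S.g.contMDiff x) hX hY
  simpa using (Bundle.contMDiffAt_totalSpace.1 h1).2

lemma RiemannCartan.hasDerivAt_metric (S : RiemannCartan M)
    {X Y : ∀ x : M, TangentSpace (𝓡 4) x} {γ : ℝ → M} {t : ℝ}
    (hγ : MDifferentiableAt 𝓘(ℝ, ℝ) (𝓡 4) γ t)
    (hX : FieldSmoothAt X (γ t)) (hY : FieldSmoothAt Y (γ t)) :
    HasDerivAt (fun s ↦ S.g.val (γ s) (X (γ s)) (Y (γ s)))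
      (S.g.val (γ t) (S.D X (γ t) (curveVelocity γ t)) (Y (γ t)) +
        S.g.val (γ t) (X (γ t)) (S.D Y (γ t) (curveVelocity γ t))) t := by
  rw [← S.compatible X Y (γ t) (hX.mdifferentiableAt (by simp)) (hY.mdifferentiableAt (by simp))]
  exact hasDerivAt_comp_curve (f := fun y ↦ S.g.val y (X y) (Y y))
    ((S.contMDiffAt_metric hX hY).mdifferentiableAt (by simp)) hγ

/-- Expanding `Z` in the coordinate frame and applying Leibniz gives the defining sum, since the
derivative of a coefficient along the velocity depends only on its values on the curve. -/
lemma covDerivAlong_eq_of_eventuallyEq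
    (D : CovariantDerivative (𝓡 4) R4 (TangentSpace (𝓡 4) : M → Type _))
    {γ : ℝ → M} {t : ℝ} (hγ : MDifferentiableAt 𝓘(ℝ, ℝ) (𝓡 4) γ t)
    {V : ∀ t, TangentSpace (𝓡 4) (γ t)} {Z : ∀ x : M, TangentSpace (𝓡 4) x}
    (hZ : FieldMDiffAt Z (γ t)) (hV : ∀ᶠ s in 𝓝 t, V s = Z (γ s)) :
    covDerivAlong D γ V t = D Z (γ t) (curveVelocity γ t) := by
  let e := trivializationAt R4 (TangentSpace (𝓡 4) : M → Type _) (γ t)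
  let b := (EuclideanSpace.basisFun (Fin 4) ℝ).toBasis
  have he : γ t ∈ e.baseSet := FiberBundle.mem_baseSet_trivializationAt' _
  have hc : ∀ i, MDifferentiableAt (𝓡 4) 𝓘(ℝ, ℝ) (fun x ↦ e.localFrameCoeff (𝓡 4) b i x (Z x)) (γ t) := fun i ↦
    mdifferentiableAt_localFrameCoeff b he hZ i
  have hs : ∀ i, FieldMDiffAt (e.localFrame b i) (γ t) := fun i ↦
    (contMDiffAt_localFrame_of_mem (I := 𝓡 4) 1 e b i he).mdifferentiableAt (by simp)
  have h1 := D.congr_of_eventuallyEq hZ (e.eventually_eq_localFrame_sum_coeff_smul (I := 𝓡 4) b he)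
  have h2 := D.sum_smul_apply Finset.univ (fun i _ ↦ hc i) (fun i _ ↦ hs i) (curveVelocity γ t)
  rw [h1, h2]
  unfold covDerivAlong
  refine Finset.sum_congr rfl fun i _ ↦ ?_
  have h3 : deriv (fun s ↦ e.localFrameCoeff (𝓡 4) b i (γ s) (V s)) t =
      mvfderiv (𝓡 4) (fun x ↦ e.localFrameCoeff (𝓡 4) b i x (Z x)) (γ t) (curveVelocity γ t) := by
    rw [← (hasDerivAt_comp_curve (hc i) hγ).deriv]
    exact EventuallyEq.deriv_eq (hV.mono fun s hs ↦ by simp only [hs])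
  change deriv (fun s ↦ e.localFrameCoeff (𝓡 4) b i (γ s) (V s)) t • e.localFrame b i (γ t) +
    e.localFrameCoeff (𝓡 4) b i (γ t) (V t) • D (e.localFrame b i) (γ t) (curveVelocity γ t) = _
  rw [h3, hV.self_of_nhds, add_comm]

end ManifoldBasics

/-! ### Christoffel symbols and local extension of fields along a curve -/

section LocalParallel

open Filter Topology Set

variable {M : Type*} [TopologicalSpace M] [ChartedSpace R4 M] [IsManifold (𝓡 4) ∞ M]

/-- The coordinate vector field `∂_i` of the preferred chart at `x₀`. -/
noncomputable def coordField (x₀ : M) (i : Fin 4) : ∀ x : M, TangentSpace (𝓡 4) x :=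
  (trivializationAt R4 (TangentSpace (𝓡 4) : M → Type _) x₀).localFrame
    (EuclideanSpace.basisFun (Fin 4) ℝ).toBasis i

/-- The coordinates of a tangent vector at `x` in the preferred chart at `x₀`. -/
noncomputable def coords (x₀ x : M) : TangentSpace (𝓡 4) x →L[ℝ] R4 :=
  (trivializationAt R4 (TangentSpace (𝓡 4) : M → Type _) x₀).continuousLinearMapAt ℝ x

lemma localFrameCoeff_eq_coords {x₀ x : M} (hx : x ∈ (chartAt R4 x₀).source) (i : Fin 4)
    (v : TangentSpace (𝓡 4) x) :
    (trivializationAt R4 (TangentSpace (𝓡 4) : M → Type _) x₀).localFrameCoeff (𝓡 4)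
      (EuclideanSpace.basisFun (Fin 4) ℝ).toBasis i x v = coords x₀ x v i := by
  classical
  let e := trivializationAt R4 (TangentSpace (𝓡 4) : M → Type _) x₀
  have he : x ∈ e.baseSet := hx
  -- The single vector `v` is viewed as the value at `x` of the section that vanishes elsewhere.
  have h := e.localFrameCoeff_eq_coeff (I := 𝓡 4) (b := (EuclideanSpace.basisFun (Fin 4) ℝ).toBasis)
    (s := Function.update 0 x v) he (i := i)
  simp only [Function.update_self] at h
  rw [h]
  simp [coords, Bundle.Trivialization.linearMapAt_apply, hx, e]

lemma sum_coords_smul_coordField {x₀ x : M} (hx : x ∈ (chartAt R4 x₀).source)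
    (v : TangentSpace (𝓡 4) x) : ∑ i, coords x₀ x v i • coordField x₀ i x = v := by
  classical
  let e := trivializationAt R4 (TangentSpace (𝓡 4) : M → Type _) x₀
  have he : x ∈ e.baseSet := hx
  have h := e.eq_sum_localFrameCoeff_smul (I := 𝓡 4)
    (b := (EuclideanSpace.basisFun (Fin 4) ℝ).toBasis) (s := Function.update 0 x v) he
  simp only [Function.update_self] at h
  rw [h]
  exact Finset.sum_congr rfl fun i _ ↦ by rw [← h, localFrameCoeff_eq_coords hx]; rfl

lemma fieldSmoothAt_coordField {x₀ x : M} (hx : x ∈ (chartAt R4 x₀).source) (i : Fin 4) :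
    FieldSmoothAt (coordField x₀ i) x :=
  contMDiffAt_localFrame_of_mem (I := 𝓡 4) ∞ _ _ i hx

lemma contMDiffAt_coords {x₀ x : M} (hx : x ∈ (chartAt R4 x₀).source) (i : Fin 4)
    {X : ∀ x : M, TangentSpace (𝓡 4) x} (hX : FieldSmoothAt X x) :
    SmoothFunAt (fun y ↦ coords x₀ y (X y) i) x := by
  refine (contMDiffAt_localFrameCoeff (I := 𝓡 4) (EuclideanSpace.basisFun (Fin 4) ℝ).toBasis
    (e := trivializationAt R4 (TangentSpace (𝓡 4) : M → Type _) x₀) hx hX i).congr_of_eventuallyEq ?_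
  filter_upwards [(chartAt R4 x₀).open_source.mem_nhds hx] with y hy
  exact (localFrameCoeff_eq_coords hy i (X y)).symm

lemma hasMFDerivAt_extChartAt_coords {x₀ x : M} (hx : x ∈ (chartAt R4 x₀).source) :
    HasMFDerivAt (𝓡 4) 𝓘(ℝ, R4) (extChartAt (𝓡 4) x₀) x (coords x₀ x) := by
  have h := (mdifferentiableAt_extChartAt (I := 𝓡 4) hx).hasMFDerivAt
  rw [← TangentBundle.continuousLinearMapAt_trivializationAt hx] at h
  exact h

lemma fieldSmoothAt_of_coords {x₀ x : M} (hx : x ∈ (chartAt R4 x₀).source)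
    {f : R4 → R4} (hf : ContDiffAt ℝ ∞ f (extChartAt (𝓡 4) x₀ x)) :
    (∀ i, SmoothFunAt (fun y ↦ f (extChartAt (𝓡 4) x₀ y) i) x) ∧
    FieldSmoothAt (fun y ↦ ∑ i, f (extChartAt (𝓡 4) x₀ y) i • coordField x₀ i y) x := by
  have h : ∀ i, SmoothFunAt (fun y ↦ f (extChartAt (𝓡 4) x₀ y) i) x := fun i ↦ by
    have h1 : ContDiffAt ℝ ∞ (fun p ↦ f p i) (extChartAt (𝓡 4) x₀ x) :=
      (EuclideanSpace.proj (𝕜 := ℝ) i).contDiff.contDiffAt.comp _ hf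
    exact h1.contMDiffAt.comp x (contMDiffAt_extChartAt' hx)
  exact ⟨h, ContMDiffAt.sum_section fun i _ ↦ (h i).smul_section (fieldSmoothAt_coordField hx i)⟩

/-- The curve read in the preferred chart at `x₀`. -/
lemma deriv_extChartAt_comp_curve {γ : ℝ → M} {t : ℝ} {x₀ : M}
    (hγ : ContMDiffAt 𝓘(ℝ, ℝ) (𝓡 4) ∞ γ t) (hx : γ t ∈ (chartAt R4 x₀).source) :
    ContDiffAt ℝ ∞ (fun s ↦ extChartAt (𝓡 4) x₀ (γ s)) t ∧
      deriv (fun s ↦ extChartAt (𝓡 4) x₀ (γ s)) t = coords x₀ (γ t) (curveVelocity γ t) := by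
  refine ⟨contMDiffAt_iff_contDiffAt.1 ((contMDiffAt_extChartAt' hx).comp t hγ), ?_⟩
  have h1 := (hasMFDerivAt_extChartAt_coords hx).comp t
    (hγ.mdifferentiableAt (by simp)).hasMFDerivAt
  let A : ℝ →L[ℝ] R4 := (coords x₀ (γ t)).comp (mfderiv 𝓘(ℝ, ℝ) (𝓡 4) γ t)
  have h2 : HasFDerivAt (extChartAt (𝓡 4) x₀ ∘ γ) A t := hasMFDerivAt_iff_hasFDerivAt.1 h1
  exact h2.hasDerivAt.deriv

/-- Smoothness of `D` is applied below to globally smooth fields, so the coordinate fields are cut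
off by a bump function. -/
lemma exists_smooth_field_eventuallyEq_coordField [T2Space M] (x₀ : M) (i : Fin 4) :
    ∃ X : ∀ x : M, TangentSpace (𝓡 4) x, (∀ x, FieldSmoothAt X x) ∧
      ∀ᶠ x in 𝓝 x₀, X x = coordField x₀ i x := by
  let ψ : SmoothBumpFunction (𝓡 4) x₀ := Classical.arbitrary _
  refine ⟨fun x ↦ ψ x • coordField x₀ i x, ?_, ?_⟩
  · exact ContMDiffOn.smul_section_of_tsupport (u := (chartAt R4 x₀).source)
      ψ.contMDiff.contMDiffOn (chartAt R4 x₀).open_source ψ.tsupport_subset_chartAt_source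
      (fun x hx ↦ (fieldSmoothAt_coordField hx i).contMDiffWithinAt)
  · filter_upwards [ψ.eventuallyEq_one] with x hx
    simp [hx]

/-- In the preferred chart at `x₀`, a smooth connection is given by smooth coefficients. -/
lemma exists_christoffel [T2Space M]
    (D : CovariantDerivative (𝓡 4) R4 (TangentSpace (𝓡 4) : M → Type _))
    (hD : D.ContMDiffCovariantDerivative ∞) (x₀ : M) :
    ∃ Ω : R4 → R4 →L[ℝ] R4 →L[ℝ] R4,
      (∀ᶠ p in 𝓝 (extChartAt (𝓡 4) x₀ x₀), ContDiffAt ℝ ∞ Ω p) ∧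
      ∀ᶠ x in 𝓝 x₀, ∀ (v : TangentSpace (𝓡 4) x) (y : R4),
        ∑ k, Ω (extChartAt (𝓡 4) x₀ x) (coords x₀ x v) y k • coordField x₀ k x =
          ∑ i, y i • D (coordField x₀ i) x v := by
  choose X hX hXe using exists_smooth_field_eventuallyEq_coordField x₀
  let φ := extChartAt (𝓡 4) x₀
  -- Near `x₀` these are the Christoffel symbols: the `k`-th coordinate of `D_{∂_j} ∂_i`.
  let κ : Fin 4 → Fin 4 → Fin 4 → M → ℝ := fun i j k x ↦
    coords x₀ x (D (X i) x (coordField x₀ j x)) k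
  have hDX : ∀ i j x, x ∈ (chartAt R4 x₀).source →
      FieldSmoothAt (fun x ↦ D (X i) x (coordField x₀ j x)) x := fun i j x hx ↦ by
    have h1 := hD.contMDiff.contMDiff (σ := X i) (fun x _ ↦ (hX i x).contMDiffWithinAt)
    exact ContMDiffAt.clm_bundle_apply (h1.contMDiffAt univ_mem) (fieldSmoothAt_coordField hx j)
  have hκ : ∀ i j k x, x ∈ (chartAt R4 x₀).source → SmoothFunAt (κ i j k) x :=
    fun i j k x hx ↦ contMDiffAt_coords hx k (hDX i j x hx)
  -- `C i j k` is the constant bilinear map `(w, y) ↦ w_j y_i e_k`.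
  let C : Fin 4 → Fin 4 → Fin 4 → R4 →L[ℝ] R4 →L[ℝ] R4 := fun i j k ↦
    (EuclideanSpace.proj (𝕜 := ℝ) j).smulRight
      ((EuclideanSpace.proj (𝕜 := ℝ) i).smulRight (EuclideanSpace.single k (1 : ℝ)))
  refine ⟨fun p ↦ ∑ i, ∑ j, ∑ k, κ i j k (φ.symm p) • C i j k, ?_, ?_⟩
  · have : φ.target ∈ 𝓝 (φ x₀) := extChartAt_target_mem_nhds x₀
    filter_upwards [this] with p hp
    suffices key : ∀ i j k, ContDiffAt ℝ ∞ (fun p ↦ κ i j k (φ.symm p)) p by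
      have h1 := contDiffAt_sum_smul_const
        (κ := fun (m : Fin 4 × Fin 4 × Fin 4) p ↦ κ m.1 m.2.1 m.2.2 (φ.symm p))
        (fun m ↦ key m.1 m.2.1 m.2.2) (fun m ↦ C m.1 m.2.1 m.2.2)
      simp only [Fintype.sum_prod_type] at h1
      exact h1
    intro i j k
    have h1 : ContMDiffAt 𝓘(ℝ, R4) (𝓡 4) ∞ φ.symm p :=
      (contMDiffOn_extChartAt_symm x₀).contMDiffAt ((isOpen_extChartAt_target x₀).mem_nhds hp)
    have h2 : φ.symm p ∈ (chartAt R4 x₀).source := by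
      simpa [φ] using φ.map_target hp
    exact contMDiffAt_iff_contDiffAt.1 ((hκ i j k _ h2).comp p h1)
  · have h1 : ∀ᶠ x in 𝓝 x₀, ∀ i, ∀ᶠ z in 𝓝 x, X i z = coordField x₀ i z :=
      eventually_all.2 fun i ↦ (hXe i).eventually_nhds
    filter_upwards [h1, (chartAt R4 x₀).open_source.mem_nhds (mem_chart_source R4 x₀)]
      with x hx hxs v y
    have hinv : φ.symm (φ x) = x := φ.left_inv (by simpa [φ] using hxs)
    have h2 : ∀ i, D (coordField x₀ i) x = D (X i) x := fun i ↦
      (D.congr_of_eventuallyEq ((hX i x).mdifferentiableAt (by simp)) (hx i)).symm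
    have h3 : ∀ i, D (X i) x v = ∑ j, ∑ k, (coords x₀ x v j * κ i j k x) • coordField x₀ k x := by
      intro i
      conv_lhs => rw [← sum_coords_smul_coordField hxs v]
      rw [map_sum]
      refine Finset.sum_congr rfl fun j _ ↦ ?_
      rw [map_smul]
      conv_lhs => rw [← sum_coords_smul_coordField hxs (D (X i) x (coordField x₀ j x))]
      simp [Finset.smul_sum, mul_smul, κ]
    simp only [h2, h3]
    change ∑ k, (∑ i, ∑ j, ∑ k, κ i j k (φ.symm (φ x)) • C i j k) (coords x₀ x v) y k • _ = _
    rw [hinv]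
    have h4 : ∀ (w : R4) (k : Fin 4), (∑ i, ∑ j, ∑ k, κ i j k x • C i j k) w y k =
        ∑ i, ∑ j, y i * (w j * κ i j k x) := by
      intro w k
      have hC : ∀ i j k', (C i j k' w y) k = if k = k' then w j * y i else 0 := by
        intro i j k'
        by_cases h : k = k' <;> simp [C, h]
      simp only [sum_apply, smul_apply, WithLp.ofLp_sum, Finset.sum_apply, PiLp.smul_apply, hC,
        smul_eq_mul, mul_ite, mul_zero, Finset.sum_ite_eq, Finset.mem_univ, if_true]
      exact Finset.sum_congr rfl fun i _ ↦ Finset.sum_congr rfl fun j _ ↦ by ring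
    simp only [h4, Finset.sum_smul, Finset.smul_sum, smul_smul]
    rw [Finset.sum_comm]
    exact Finset.sum_congr rfl fun i _ ↦ Finset.sum_comm

/-- Through a point of a smooth immersed curve, every tangent vector extends to a smooth vector
field whose covariant derivative vanishes along the curve, in all directions. -/
lemma exists_local_parallel_field [T2Space M]
    (D : CovariantDerivative (𝓡 4) R4 (TangentSpace (𝓡 4) : M → Type _))
    (hD : D.ContMDiffCovariantDerivative ∞) {γ : ℝ → M} {t₀ : ℝ}
    (hγ : ∀ᶠ t in 𝓝 t₀, ContMDiffAt 𝓘(ℝ, ℝ) (𝓡 4) ∞ γ t) (hvel : curveVelocity γ t₀ ≠ 0)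
    (v : TangentSpace (𝓡 4) (γ t₀)) :
    ∃ X : ∀ x : M, TangentSpace (𝓡 4) x, X (γ t₀) = v ∧
      (∀ᶠ x in 𝓝 (γ t₀), FieldSmoothAt X x) ∧ ∀ᶠ t in 𝓝 t₀, D X (γ t) = 0 := by
  let x₀ := γ t₀
  let φ := extChartAt (𝓡 4) x₀
  have hcont : Tendsto γ (𝓝 t₀) (𝓝 x₀) := hγ.self_of_nhds.continuousAt
  have hsrc : ∀ᶠ x in 𝓝 x₀, x ∈ (chartAt R4 x₀).source :=
    (chartAt R4 x₀).open_source.mem_nhds (mem_chart_source R4 x₀)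
  have hφ : Tendsto φ (𝓝 x₀) (𝓝 (φ x₀)) := continuousAt_extChartAt x₀
  obtain ⟨Ω, hΩ, hΩD⟩ := exists_christoffel D hD x₀
  have hc : ∀ᶠ t in 𝓝 t₀, ContDiffAt ℝ ∞ (fun s ↦ φ (γ s)) t := by
    filter_upwards [hγ, hcont.eventually hsrc] with t h1 h2
    exact (deriv_extChartAt_comp_curve h1 h2).1
  have hc' : deriv (fun s ↦ φ (γ s)) t₀ ≠ 0 := by
    rw [(deriv_extChartAt_comp_curve hγ.self_of_nhds hsrc.self_of_nhds).2]
    intro h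
    apply hvel
    rw [← sum_coords_smul_coordField hsrc.self_of_nhds (curveVelocity γ t₀), h]
    simp
  obtain ⟨Y, hY₀, hYs, hY⟩ := exists_parallel_extension hc hc' hΩ
  let u := coords x₀ x₀ v
  refine ⟨fun x ↦ ∑ i, Y (φ x) u i • coordField x₀ i x, ?_, ?_, ?_⟩
  · change ∑ i, Y (φ (γ t₀)) u i • _ = _
    rw [hY₀]
    exact sum_coords_smul_coordField hsrc.self_of_nhds v
  · filter_upwards [hsrc, hφ.eventually hYs] with x h1 h2
    exact (fieldSmoothAt_of_coords h1 (h2.clm_apply contDiffAt_const)).2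
  · filter_upwards [hY, hcont.eventually hsrc, (hφ.comp hcont).eventually hYs,
      hcont.eventually hΩD] with t h1 h2 h3 h4
    ext w
    have hs := fieldSmoothAt_of_coords h2 (f := fun p ↦ Y p u) (h3.clm_apply contDiffAt_const)
    rw [D.sum_smul_apply Finset.univ (f := fun i x ↦ Y (φ x) u i) (X := coordField x₀)
      (fun i _ ↦ (hs.1 i).mdifferentiableAt (by simp))
      (fun i _ ↦ (fieldSmoothAt_coordField h2 i).mdifferentiableAt (by simp))]
    -- The differential of the components is minus the Christoffel term, so the two halves of the
    -- Leibniz sum cancel.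
    have h5 : ∀ i, mvfderiv (𝓡 4) (fun x ↦ Y (φ x) u i) (γ t) w =
        -(Ω (φ (γ t)) (coords x₀ (γ t) w) (Y (φ (γ t)) u)) i := by
      intro i
      have e1 : HasFDerivAt (fun p ↦ Y p u i)
          ((EuclideanSpace.proj (𝕜 := ℝ) i).comp ((fderiv ℝ Y (φ (γ t))).flip u)) (φ (γ t)) :=
        (EuclideanSpace.proj (𝕜 := ℝ) i).hasFDerivAt.comp _
          (((h3.differentiableAt (by simp)).hasFDerivAt.clm_apply
            (hasFDerivAt_const u _)).congr_fderiv (by ext; simp))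
      have e2 := (e1.hasMFDerivAt.comp (γ t) (hasMFDerivAt_extChartAt_coords h2)).mfderiv
      have e3 := h1 (coords x₀ (γ t) w) u
      have e4 : mvfderiv (𝓡 4) (fun x ↦ Y (φ x) u i) (γ t) w =
        (fderiv ℝ Y (φ (γ t)) (coords x₀ (γ t) w) u) i := congrArg (fun A ↦ A w) e2
      rw [e4, e3]
      rfl
    simp only [h5]
    rw [Finset.sum_add_distrib, ← h4 w (Y (φ (γ t)) u), ← Finset.sum_add_distrib]
    simp [φ]

/-- The velocity of a smooth immersed curve extends to a smooth vector field. -/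
lemma exists_field_extending_velocity {γ : ℝ → M} {t₀ : ℝ}
    (hγ : ∀ᶠ t in 𝓝 t₀, ContMDiffAt 𝓘(ℝ, ℝ) (𝓡 4) ∞ γ t) (hvel : curveVelocity γ t₀ ≠ 0) :
    ∃ Z : ∀ x : M, TangentSpace (𝓡 4) x,
      (∀ᶠ x in 𝓝 (γ t₀), FieldSmoothAt Z x) ∧ ∀ᶠ t in 𝓝 t₀, curveVelocity γ t = Z (γ t) := by
  let x₀ := γ t₀
  let φ := extChartAt (𝓡 4) x₀
  have hcont : Tendsto γ (𝓝 t₀) (𝓝 x₀) := hγ.self_of_nhds.continuousAt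
  have hsrc : ∀ᶠ x in 𝓝 x₀, x ∈ (chartAt R4 x₀).source :=
    (chartAt R4 x₀).open_source.mem_nhds (mem_chart_source R4 x₀)
  have hφ : Tendsto φ (𝓝 x₀) (𝓝 (φ x₀)) := continuousAt_extChartAt x₀
  have hc : ∀ᶠ t in 𝓝 t₀, ContDiffAt ℝ ∞ (fun s ↦ φ (γ s)) t := by
    filter_upwards [hγ, hcont.eventually hsrc] with t h1 h2
    exact (deriv_extChartAt_comp_curve h1 h2).1
  have hc' : deriv (fun s ↦ φ (γ s)) t₀ ≠ 0 := by
    rw [(deriv_extChartAt_comp_curve hγ.self_of_nhds hsrc.self_of_nhds).2]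
    intro h
    apply hvel
    rw [← sum_coords_smul_coordField hsrc.self_of_nhds (curveVelocity γ t₀), h]
    simp
  obtain ⟨τ, hτ, hτc⟩ := exists_left_inverse_of_deriv_ne_zero hc hc'
  have hτ₀ : Tendsto τ (𝓝 (φ x₀)) (𝓝 t₀) := by
    have := hτ.self_of_nhds.continuousAt.tendsto
    rwa [hτc.self_of_nhds] at this
  -- The coordinate velocity at the parameter `τ (φ x)`, which is `t` at the point `γ t`.
  refine ⟨fun x ↦ ∑ i, deriv (fun s ↦ φ (γ s)) (τ (φ x)) i • coordField x₀ i x, ?_, ?_⟩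
  · filter_upwards [hsrc, hφ.eventually hτ, (hτ₀.comp hφ).eventually hc] with x h1 h2 h3
    exact (fieldSmoothAt_of_coords h1 (f := fun p ↦ deriv (fun s ↦ φ (γ s)) (τ p))
      (ContDiffAt.comp (g := deriv (fun s ↦ φ (γ s))) _ (h3.derivWithin (by simp)) h2)).2
  · filter_upwards [hγ, hcont.eventually hsrc, hτc] with t h1 h2 h3
    rw [h3, (deriv_extChartAt_comp_curve h1 h2).2]
    exact (sum_coords_smul_coordField h2 _).symm

end LocalParallel

/-! ### Linear algebra of Lorentz orthonormal bases -/

section Orthonormal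

open Filter Topology Set

variable {M : Type*} [TopologicalSpace M] [ChartedSpace R4 M] [IsManifold (𝓡 4) ∞ M]

lemma minkowskiEta_ne (i j : Fin 4) (h : i ≠ j) : minkowskiEta i j = 0 := by
  simp [minkowskiEta, h]

lemma minkowskiEta_mul_self (i : Fin 4) : minkowskiEta i i * minkowskiEta i i = 1 := by
  fin_cases i <;> simp [minkowskiEta]

namespace LorentzMetric

variable (g : LorentzMetric M) {x : M} {e : Fin 4 → TangentSpace (𝓡 4) x}

lemma linearIndependent_of_orthonormal (he : ∀ i j, g.val x (e i) (e j) = minkowskiEta i j) :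
    LinearIndependent ℝ e := by
  rw [Fintype.linearIndependent_iff]
  intro c hc i
  have h := congrArg (fun v ↦ g.val x v (e i)) hc
  simp only [map_sum, map_smul, sum_apply, smul_apply, he, smul_eq_mul, map_zero, zero_apply] at h
  rw [Finset.sum_eq_single i (fun j _ hj ↦ by rw [minkowskiEta_ne j i hj, mul_zero])
    (by simp)] at h
  have := minkowskiEta_mul_self i
  rcases mul_eq_zero.1 h with h | h
  · exact h
  · rw [h] at this; norm_num at this

lemma span_eq_top_of_orthonormal (he : ∀ i j, g.val x (e i) (e j) = minkowskiEta i j) :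
    ⊤ ≤ Submodule.span ℝ (range e) := by
  have : Module.finrank ℝ (TangentSpace (𝓡 4) x) = 4 := finrank_euclideanSpace_fin (𝕜 := ℝ) (n := 4)
  have hfd : FiniteDimensional ℝ (TangentSpace (𝓡 4) x) :=
    inferInstanceAs (FiniteDimensional ℝ R4)
  exact ((g.linearIndependent_of_orthonormal he).span_eq_top_of_card_eq_finrank
    (by rw [Fintype.card_fin]; exact this.symm)).ge

/-- Pairing with `e i` extracts the `i`-th coefficient up to the sign `η_ii`, whose square is one.
Constancy of a field relative to a parallel frame can thus be read off from inner products. -/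
lemma eq_sum_of_orthonormal (he : ∀ i j, g.val x (e i) (e j) = minkowskiEta i j)
    (v : TangentSpace (𝓡 4) x) :
    v = ∑ i, (minkowskiEta i i * g.val x v (e i)) • e i := by
  let b := Module.Basis.mk (g.linearIndependent_of_orthonormal he) (g.span_eq_top_of_orthonormal he)
  have hb : ∀ i, b i = e i := fun i ↦ Module.Basis.mk_apply _ _ i
  have hv := b.sum_repr v
  simp only [hb] at hv
  have h : ∀ i, minkowskiEta i i * g.val x v (e i) = b.repr v i := by
    intro i
    conv_lhs => rw [← hv]
    simp only [map_sum, map_smul, sum_apply, smul_apply, he, smul_eq_mul]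
    rw [Finset.sum_eq_single i (fun j _ hj ↦ by rw [minkowskiEta_ne j i hj, mul_zero])
      (by simp), mul_comm, mul_assoc, minkowskiEta_mul_self, mul_one]
  simp only [h]
  exact hv.symm

/-- A vector of norm one is the first vector of an orthonormal basis. -/
lemma exists_orthonormal_of_unit (v : TangentSpace (𝓡 4) x) (hv : g.val x v v = 1) :
    ∃ e : Fin 4 → TangentSpace (𝓡 4) x, e 0 = v ∧
      ∀ i j, g.val x (e i) (e j) = minkowskiEta i j := by
  obtain ⟨b, hb⟩ := g.signature x
  have h00 : g.val x (b 0) (b 0) = 1 := by rw [hb]; simp [minkowskiEta]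
  -- The reflection in the hyperplane orthogonal to a non-null vector `n` is an isometry.
  have refl : ∀ n : TangentSpace (𝓡 4) x, g.val x n n ≠ 0 → ∀ u w,
      g.val x (u - (2 * g.val x u n / g.val x n n) • n) (w - (2 * g.val x w n / g.val x n n) • n) =
        g.val x u w := by
    intro n hn u w
    simp only [map_sub, map_smul, sub_apply, smul_apply, smul_eq_mul]
    rw [g.symm x n w]
    field_simp
    ring
  have hs := g.symm x v (b 0)
  -- The reflection along `b 0 - v` sends `b 0` to `v`, but needs `g (b 0, v) ≠ 1` for that vector
  -- to be non-null. Otherwise `b 0 + v` has square norm `4`, its reflection sends `b 0` to `-v`,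
  -- and the sign of the first vector is flipped.
  by_cases h : g.val x (b 0) v = 1
  · have hn : g.val x (b 0 + v) (b 0 + v) = 4 := by
      simp only [map_add, add_apply]; rw [hs, h00, hv, h]; norm_num
    refine ⟨fun i ↦ (if i = 0 then (-1 : ℝ) else 1) • (b i -
      (2 * g.val x (b i) (b 0 + v) / g.val x (b 0 + v) (b 0 + v)) • (b 0 + v)), ?_, fun i j ↦ ?_⟩
    · rw [hn]
      simp only [map_add, h00, h, if_true]
      module
    · simp only [map_smul, smul_apply, refl _ (by rw [hn]; norm_num : g.val x (b 0 + v) (b 0 + v) ≠ 0),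
        hb, smul_eq_mul]
      by_cases hij : i = j
      · subst hij; split_ifs <;> ring
      · rw [minkowskiEta_ne i j hij]; ring
  · have hn : g.val x (b 0 - v) (b 0 - v) = 2 * (1 - g.val x (b 0) v) := by
      simp only [map_sub, sub_apply]; rw [hs, h00, hv]; ring
    have hne : (1 - g.val x (b 0) v) ≠ 0 := sub_ne_zero.2 (Ne.symm h)
    refine ⟨fun i ↦ b i -
      (2 * g.val x (b i) (b 0 - v) / g.val x (b 0 - v) (b 0 - v)) • (b 0 - v), ?_, fun i j ↦ ?_⟩
    · have : 2 * g.val x (b 0) (b 0 - v) / g.val x (b 0 - v) (b 0 - v) = 1 := by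
        rw [hn]; simp only [map_sub, h00]; field_simp
      simp only [this]
      module
    · rw [refl _ (by rw [hn]; simpa using hne), hb]

end LorentzMetric

end Orthonormal

/-! ### Parallel transport and the parallel frame along an autoparallel -/

section ParallelTransport

open Filter Topology Set

/-- The mean value inequality on the convex set `ball ∩ K`; working in `𝓝[K] t` allows `t` to be an
end point of `K`. -/
lemma eventually_eq_of_hasDerivAt_zero {f : ℝ → ℝ} {K : Set ℝ} (hK : K.OrdConnected) {t : ℝ}
    (ht : t ∈ K) (hf : ∀ᶠ s in 𝓝[K] t, HasDerivAt f 0 s) : ∀ᶠ s in 𝓝[K] t, f s = f t := by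
  obtain ⟨ε, hε, h⟩ := Metric.mem_nhdsWithin_iff.1 hf
  refine Metric.mem_nhdsWithin_iff.2 ⟨ε, hε, fun s hs ↦ ?_⟩
  have hconv : Convex ℝ (Metric.ball t ε ∩ K) := (convex_ball t ε).inter hK.convex
  have := hconv.norm_image_sub_le_of_norm_hasDerivWithin_le (f := f) (f' := fun _ ↦ 0) (C := 0)
    (fun r hr ↦ (h hr).hasDerivWithinAt) (by simp) ⟨Metric.mem_ball_self hε, ht⟩ hs
  simpa [sub_eq_zero] using this

variable {M : Type*} [TopologicalSpace M] [ChartedSpace R4 M] [IsManifold (𝓡 4) ∞ M]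

namespace RiemannCartan

/-- The field `V` along `γ` is parallel on `K`: near every point it is the restriction of a vector
field whose covariant derivatives in all directions vanish along the curve. -/
def IsParallelAlong (S : RiemannCartan M) (γ : ℝ → M) (K : Set ℝ)
    (V : ∀ t, TangentSpace (𝓡 4) (γ t)) : Prop :=
  ∀ t ∈ K, ∃ X : ∀ x : M, TangentSpace (𝓡 4) x, (∀ᶠ x in 𝓝 (γ t), FieldSmoothAt X x) ∧
    ∀ᶠ s in 𝓝[K] t, X (γ s) = V s ∧ S.D X (γ s) = 0

variable {S : RiemannCartan M} {γ : ℝ → M} {I K : Set ℝ} {t : ℝ}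

lemma IsParallelAlong.mono {V : ∀ t, TangentSpace (𝓡 4) (γ t)} (hV : S.IsParallelAlong γ K V)
    {L : Set ℝ} (hL : L ⊆ K) : S.IsParallelAlong γ L V := fun t ht ↦ by
  obtain ⟨X, h1, h2⟩ := hV t (hL ht)
  exact ⟨X, h1, h2.filter_mono (nhdsWithin_mono t hL)⟩

/-- By compatibility the inner product has zero derivative along `γ`. Only derivatives along the
velocity are assumed to vanish, so that this also applies to an extension of the velocity field. -/
lemma eventually_metric_const (hγ : ∀ᶠ s in 𝓝 t, ContMDiffAt 𝓘(ℝ, ℝ) (𝓡 4) ∞ γ s)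
    (hK : K.OrdConnected) (ht : t ∈ K) {X Y : ∀ x : M, TangentSpace (𝓡 4) x}
    (hX : ∀ᶠ x in 𝓝 (γ t), FieldSmoothAt X x) (hY : ∀ᶠ x in 𝓝 (γ t), FieldSmoothAt Y x)
    (hDX : ∀ᶠ s in 𝓝[K] t, S.D X (γ s) (curveVelocity γ s) = 0)
    (hDY : ∀ᶠ s in 𝓝[K] t, S.D Y (γ s) (curveVelocity γ s) = 0) :
    ∀ᶠ s in 𝓝[K] t, S.g.val (γ s) (X (γ s)) (Y (γ s)) = S.g.val (γ t) (X (γ t)) (Y (γ t)) := by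
  have hc : Tendsto γ (𝓝[K] t) (𝓝 (γ t)) :=
    hγ.self_of_nhds.continuousAt.tendsto.mono_left nhdsWithin_le_nhds
  refine eventually_eq_of_hasDerivAt_zero
    (f := fun s ↦ S.g.val (γ s) (X (γ s)) (Y (γ s))) hK ht ?_
  filter_upwards [hγ.filter_mono nhdsWithin_le_nhds, hc.eventually hX, hc.eventually hY, hDX, hDY]
    with s h1 h2 h3 h4 h5
  have := S.hasDerivAt_metric (h1.mdifferentiableAt (by simp)) h2 h3
  rwa [h4, h5, map_zero, map_zero, zero_apply, add_zero] at this

/-- Locally constant on an interval, hence constant. -/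
lemma IsParallelAlong.metric_const (hγ : ∀ t ∈ K, ∀ᶠ s in 𝓝 t, ContMDiffAt 𝓘(ℝ, ℝ) (𝓡 4) ∞ γ s)
    (hK : K.OrdConnected) {V W : ∀ t, TangentSpace (𝓡 4) (γ t)} (hV : S.IsParallelAlong γ K V)
    (hW : S.IsParallelAlong γ K W) {s t : ℝ} (hs : s ∈ K) (ht : t ∈ K) :
    S.g.val (γ s) (V s) (W s) = S.g.val (γ t) (V t) (W t) := by
  refine hK.isPreconnected.induction₂
    (fun s t ↦ S.g.val (γ s) (V s) (W s) = S.g.val (γ t) (V t) (W t))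
    (fun t ht ↦ ?_) (fun x y z _ _ _ h1 h2 ↦ h1.trans h2) (fun x y _ _ h ↦ h.symm) hs ht
  obtain ⟨X, hX, hXV⟩ := hV t ht
  obtain ⟨Y, hY, hYW⟩ := hW t ht
  have h0 := eventually_metric_const (S := S) (hγ t ht) hK ht hX hY
    (hXV.mono fun s h ↦ by rw [h.2]; rfl) (hYW.mono fun s h ↦ by rw [h.2]; rfl)
  filter_upwards [h0, hXV, hYW] with s h1 h2 h3
  rw [← h2.1, ← h3.1, h1, (hXV.self_of_nhdsWithin ht).1, (hYW.self_of_nhdsWithin ht).1]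

/-- Near every point of an immersed curve there is a parallel orthonormal frame. -/
lemma exists_local_parallel_frame [T2Space M] (S : RiemannCartan M)
    (hγ : ∀ᶠ s in 𝓝 t, ContMDiffAt 𝓘(ℝ, ℝ) (𝓡 4) ∞ γ s) (hvel : curveVelocity γ t ≠ 0) :
    ∃ X : Fin 4 → ∀ x : M, TangentSpace (𝓡 4) x,
      (∀ᶠ x in 𝓝 (γ t), ∀ i, FieldSmoothAt (X i) x) ∧
      ∀ᶠ s in 𝓝 t, (∀ i, S.D (X i) (γ s) = 0) ∧
        ∀ i j, S.g.val (γ s) (X i (γ s)) (X j (γ s)) = minkowskiEta i j := by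
  obtain ⟨b, hb⟩ := S.g.signature (γ t)
  choose X hXb hX hDX using fun i ↦ exists_local_parallel_field S.D S.smooth hγ hvel (b i)
  refine ⟨X, eventually_all.2 hX, (eventually_all.2 hDX).and ?_⟩
  refine eventually_all.2 fun i ↦ eventually_all.2 fun j ↦ ?_
  have h0 := eventually_metric_const (S := S) (K := univ) hγ ordConnected_univ (mem_univ t)
    (hX i) (hX j)
    ((hDX i).filter_mono nhdsWithin_le_nhds |>.mono fun s h ↦ by rw [h]; rfl)
    ((hDX j).filter_mono nhdsWithin_le_nhds |>.mono fun s h ↦ by rw [h]; rfl)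
  rw [nhdsWithin_univ] at h0
  filter_upwards [h0] with s hs
  rw [hs, hXb, hXb, hb]

/-- Linear combinations of a parallel frame. -/
lemma parallel_frame_combination {X : Fin 4 → ∀ x : M, TangentSpace (𝓡 4) x} {x : M}
    (hX : ∀ i, FieldSmoothAt (X i) x) (c : Fin 4 → ℝ) :
    FieldSmoothAt (fun x ↦ ∑ i, c i • X i x) x ∧
      ((∀ i, S.D (X i) x = 0) → S.D (fun x ↦ ∑ i, c i • X i x) x = 0) := by
  refine ⟨ContMDiffAt.sum_section fun i _ ↦ (hX i).const_smul_section, fun h ↦ ?_⟩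
  ext v
  rw [S.D.sum_smul_apply Finset.univ (f := fun i _ ↦ c i)
    (fun i _ ↦ mdifferentiableAt_const) (fun i _ ↦ (hX i).mdifferentiableAt (by simp))]
  refine (Finset.sum_eq_zero fun i _ ↦ ?_)
  have : mvfderiv (𝓡 4) (fun _ : M ↦ c i) x = 0 := mvfderiv_const _
  rw [h, this]
  simp

/-- Against a local parallel orthonormal frame both fields have locally constant components.
Equality at one parameter is therefore equivalent to equality at nearby ones, and connectedness of
`K` propagates it. -/
lemma IsParallelAlong.eq_of_eq [T2Space M]
    (hγ : ∀ t ∈ K, ∀ᶠ s in 𝓝 t, ContMDiffAt 𝓘(ℝ, ℝ) (𝓡 4) ∞ γ s)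
    (hvel : ∀ t ∈ K, curveVelocity γ t ≠ 0)
    (hK : K.OrdConnected) {V W : ∀ t, TangentSpace (𝓡 4) (γ t)} (hV : S.IsParallelAlong γ K V)
    (hW : S.IsParallelAlong γ K W) {s t : ℝ} (hs : s ∈ K) (ht : t ∈ K) (h : V s = W s) :
    V t = W t := by
  refine (hK.isPreconnected.induction₂ (fun s t ↦ V s = W s ↔ V t = W t)
    (fun t ht ↦ ?_) (fun x y z _ _ _ h1 h2 ↦ h1.trans h2) (fun x y _ _ h ↦ h.symm) hs ht).1 h
  obtain ⟨X, hX, hXD⟩ := S.exists_local_parallel_frame (hγ t ht) (hvel t ht)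
  have key : ∀ {V : ∀ t, TangentSpace (𝓡 4) (γ t)}, S.IsParallelAlong γ K V →
      ∀ᶠ s in 𝓝[K] t, ∀ i, S.g.val (γ s) (V s) (X i (γ s)) =
        S.g.val (γ t) (V t) (X i (γ t)) := by
    intro V hV
    obtain ⟨Y, hY, hYV⟩ := hV t ht
    refine eventually_all.2 fun i ↦ ?_
    have h0 := eventually_metric_const (S := S) (hγ t ht) hK ht hY (hX.mono fun x h ↦ h i)
      (hYV.mono fun s h ↦ by rw [h.2]; rfl)
      (hXD.filter_mono nhdsWithin_le_nhds |>.mono fun s h ↦ by rw [h.1]; rfl)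
    filter_upwards [h0, hYV] with s h1 h2
    rw [← h2.1, h1, (hYV.self_of_nhdsWithin ht).1]
  filter_upwards [key hV, key hW, hXD.filter_mono nhdsWithin_le_nhds] with s h1 h2 h3
  constructor
  · intro h
    rw [S.g.eq_sum_of_orthonormal h3.2 (V s), S.g.eq_sum_of_orthonormal h3.2 (W s)]
    simp only [h, h1, h2]
  · intro h
    rw [S.g.eq_sum_of_orthonormal hXD.self_of_nhds.2 (V t),
      S.g.eq_sum_of_orthonormal hXD.self_of_nhds.2 (W t)]
    simp only [← h1, ← h2, h]

/-- Constant combinations of one local parallel frame solve the transport problem from every `r` in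
the ball. The radius does not depend on `r`, which is what the continuation argument requires. -/
lemma exists_ball_parallel [T2Space M] (S : RiemannCartan M)
    (hγ : ∀ᶠ s in 𝓝 t, ContMDiffAt 𝓘(ℝ, ℝ) (𝓡 4) ∞ γ s) (hvel : curveVelocity γ t ≠ 0) :
    ∃ ε > 0, ∀ r ∈ Metric.ball t ε, ∀ w : TangentSpace (𝓡 4) (γ r),
      ∃ W : ∀ t, TangentSpace (𝓡 4) (γ t), S.IsParallelAlong γ (Metric.ball t ε) W ∧ W r = w := by
  obtain ⟨X, hX, hXD⟩ := S.exists_local_parallel_frame hγ hvel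
  have hc : Tendsto γ (𝓝 t) (𝓝 (γ t)) := hγ.self_of_nhds.continuousAt
  obtain ⟨ε, hε, h⟩ := Metric.eventually_nhds_iff_ball.1
    ((hc.eventually hX.eventually_nhds).and hXD.eventually_nhds)
  refine ⟨ε, hε, fun r hr w ↦ ?_⟩
  let Y : ∀ x : M, TangentSpace (𝓡 4) x := fun x ↦
    ∑ i, (minkowskiEta i i * S.g.val (γ r) w (X i (γ r))) • X i x
  refine ⟨fun s ↦ Y (γ s), fun s hs ↦ ⟨Y, ?_, ?_⟩, ?_⟩
  · exact (h s hs).1.mono fun x hx ↦ (parallel_frame_combination (S := S) hx _).1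
  · filter_upwards [self_mem_nhdsWithin] with s hs
    exact ⟨rfl, (parallel_frame_combination (h s hs).1.self_of_nhds _).2
      (h s hs).2.self_of_nhds.1⟩
  · exact (S.g.eq_sum_of_orthonormal (h r hr).2.self_of_nhds.2 w).symm

/-- At a common point the extensions that witness `V` and `W` may differ, so a new one is needed:
the parallel field with the given value at `t` on a whole ball around `t`, which by uniqueness
agrees with `V` and with `W` on their pieces. -/
lemma IsParallelAlong.glue [T2Space M] {K₁ K₂ : Set ℝ}
    (hγ : ∀ t ∈ K₁ ∪ K₂, ∀ᶠ s in 𝓝 t, ContMDiffAt 𝓘(ℝ, ℝ) (𝓡 4) ∞ γ s)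
    (hvel : ∀ t ∈ K₁ ∪ K₂, curveVelocity γ t ≠ 0)
    (hK₁ : K₁.OrdConnected) (hK₂ : K₂.OrdConnected) (hc₁ : IsClosed K₁) (hc₂ : IsClosed K₂)
    {V W : ∀ t, TangentSpace (𝓡 4) (γ t)} (hV : S.IsParallelAlong γ K₁ V)
    (hW : S.IsParallelAlong γ K₂ W) {r : ℝ} (hr₁ : r ∈ K₁) (hr₂ : r ∈ K₂) (h : V r = W r) :
    ∃ U : ∀ t, TangentSpace (𝓡 4) (γ t), S.IsParallelAlong γ (K₁ ∪ K₂) U ∧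
      (∀ t ∈ K₁, U t = V t) ∧ ∀ t ∈ K₂, U t = W t := by
  classical
  let U : ∀ t, TangentSpace (𝓡 4) (γ t) := fun t ↦ if t ∈ K₁ then V t else W t
  have hU₁ : ∀ t ∈ K₁, U t = V t := fun t ht ↦ if_pos ht
  have hU₂ : ∀ t ∈ K₂, U t = W t := fun t ht ↦ by
    by_cases ht₁ : t ∈ K₁
    · rw [hU₁ t ht₁]
      exact IsParallelAlong.eq_of_eq (K := K₁ ∩ K₂) (fun t ht ↦ hγ t (Or.inl ht.1))
        (fun t ht ↦ hvel t (Or.inl ht.1)) (hK₁.inter hK₂) (hV.mono inter_subset_left)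
        (hW.mono inter_subset_right) ⟨hr₁, hr₂⟩ ⟨ht₁, ht⟩ h
    · exact if_neg ht₁
  refine ⟨U, fun t ht ↦ ?_, hU₁, hU₂⟩
  obtain ⟨ε, hε, hball⟩ := S.exists_ball_parallel (hγ t ht) (hvel t ht)
  obtain ⟨Y, hY, hYt⟩ := hball t (Metric.mem_ball_self hε) (U t)
  obtain ⟨X, hX, hXY⟩ := hY t (Metric.mem_ball_self hε)
  have hXY' : ∀ᶠ s in 𝓝 t, X (γ s) = Y s ∧ S.D X (γ s) = 0 := by
    rwa [Metric.isOpen_ball.nhdsWithin_eq (Metric.mem_ball_self hε)] at hXY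
  -- If `t ∉ K`, closedness of `K` makes the claim vacuous near `t`.
  have key : ∀ {K : Set ℝ} {V : ∀ t, TangentSpace (𝓡 4) (γ t)}, K ⊆ K₁ ∪ K₂ → K.OrdConnected →
      IsClosed K → S.IsParallelAlong γ K V → (∀ s ∈ K, U s = V s) →
      ∀ᶠ s in 𝓝 t, s ∈ K → Y s = U s := by
    intro K V hKs hK hcl hV hUV
    by_cases htK : t ∈ K
    · filter_upwards [Metric.ball_mem_nhds t hε] with s hs hsK
      rw [hUV s hsK]
      refine IsParallelAlong.eq_of_eq (K := Metric.ball t ε ∩ K) (fun t ht ↦ hγ t (hKs ht.2))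
        (fun t ht ↦ hvel t (hKs ht.2)) (((convex_ball t ε).ordConnected).inter hK)
        (hY.mono inter_subset_left) (hV.mono inter_subset_right)
        ⟨Metric.mem_ball_self hε, htK⟩ ⟨hs, hsK⟩ (by rw [hYt, hUV t htK])
    · filter_upwards [hcl.isOpen_compl.mem_nhds htK] with s hs hsK
      exact absurd hsK hs
  refine ⟨X, hX, ?_⟩
  filter_upwards [(key subset_union_left hK₁ hc₁ hV hU₁).filter_mono nhdsWithin_le_nhds,
    (key subset_union_right hK₂ hc₂ hW hU₂).filter_mono nhdsWithin_le_nhds,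
    hXY'.filter_mono nhdsWithin_le_nhds, self_mem_nhdsWithin] with s h1 h2 h3 h4
  exact ⟨h3.1.trans (h4.elim h1 h2), h3.2⟩

/-- Parallel transport along a curve. -/
theorem exists_parallel_transport [T2Space M] (S : RiemannCartan M) (hI : I.OrdConnected)
    (hγ : ∀ t ∈ I, ∀ᶠ s in 𝓝 t, ContMDiffAt 𝓘(ℝ, ℝ) (𝓡 4) ∞ γ s)
    (hvel : ∀ t ∈ I, curveVelocity γ t ≠ 0) {t₀ : ℝ} (ht₀ : t₀ ∈ I)
    (v : TangentSpace (𝓡 4) (γ t₀)) :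
    ∃ V : ∀ t, TangentSpace (𝓡 4) (γ t), S.IsParallelAlong γ I V ∧ V t₀ = v := by
  have hsub : ∀ {s t}, s ∈ I → t ∈ I → uIcc s t ⊆ I := fun hs ht ↦ hI.uIcc_subset hs ht
  have glue : ∀ {s t}, s ∈ I → t ∈ I → ∀ {V W : ∀ t, TangentSpace (𝓡 4) (γ t)},
      S.IsParallelAlong γ (uIcc t₀ s) V → S.IsParallelAlong γ (uIcc s t) W → V s = W s →
      V t₀ = v → ∃ U : ∀ t, TangentSpace (𝓡 4) (γ t), S.IsParallelAlong γ (uIcc t₀ t) U ∧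
        U t₀ = v ∧ U t = W t := by
    intro s t hs ht V W hV hW h h₀
    have hsub' : uIcc t₀ s ∪ uIcc s t ⊆ I := union_subset (hsub ht₀ hs) (hsub hs ht)
    obtain ⟨U, hU, hU₁, hU₂⟩ := hV.glue (fun r hr ↦ hγ r (hsub' hr)) (fun r hr ↦ hvel r (hsub' hr))
      ordConnected_uIcc ordConnected_uIcc isClosed_Icc isClosed_Icc hW right_mem_uIcc
      left_mem_uIcc h
    exact ⟨U, hU.mono uIcc_subset_uIcc_union_uIcc, by rw [hU₁ _ left_mem_uIcc, h₀],
      hU₂ _ right_mem_uIcc⟩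
  -- `A t`: transport from `t₀` reaches `t`. On each ball of `exists_ball_parallel`, `A` holds at
  -- the centre iff it holds at any other point of `I` in the ball; connectedness of `I` does the
  -- rest.
  let A : ℝ → Prop := fun t ↦
    ∃ V : ∀ t, TangentSpace (𝓡 4) (γ t), S.IsParallelAlong γ (uIcc t₀ t) V ∧ V t₀ = v
  have hball : ∀ {t ε s}, s ∈ Metric.ball t ε → uIcc t s ⊆ Metric.ball t ε := fun {t ε s} hs ↦
    (convex_ball t ε).ordConnected.uIcc_subset
      (Metric.mem_ball_self (dist_nonneg.trans_lt hs)) hs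
  have hA₀ : A t₀ := by
    obtain ⟨ε, hε, hb⟩ := S.exists_ball_parallel (hγ t₀ ht₀) (hvel t₀ ht₀)
    obtain ⟨W, hW, hWv⟩ := hb t₀ (Metric.mem_ball_self hε) v
    exact ⟨W, hW.mono (hball (Metric.mem_ball_self hε)), hWv⟩
  have hA : ∀ t ∈ I, A t := by
    intro t ht
    refine (hI.isPreconnected.induction₂ (fun s t ↦ A s ↔ A t) (fun t ht ↦ ?_)
      (fun x y z _ _ _ h1 h2 ↦ h1.trans h2) (fun x y _ _ h ↦ h.symm) ht₀ ht).1 hA₀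
    obtain ⟨ε, hε, hb⟩ := S.exists_ball_parallel (hγ t ht) (hvel t ht)
    filter_upwards [nhdsWithin_le_nhds (Metric.ball_mem_nhds t hε), self_mem_nhdsWithin] with s hs hsI
    constructor
    · rintro ⟨V, hV, hV₀⟩
      obtain ⟨W, hW, hWt⟩ := hb t (Metric.mem_ball_self hε) (V t)
      obtain ⟨U, hU, hU₀, -⟩ := glue ht hsI hV (hW.mono (hball hs)) hWt.symm hV₀
      exact ⟨U, hU, hU₀⟩
    · rintro ⟨V, hV, hV₀⟩
      obtain ⟨W, hW, hWs⟩ := hb s hs (V s)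
      obtain ⟨U, hU, hU₀, -⟩ := glue hsI ht hV (hW.mono (by rw [uIcc_comm]; exact hball hs))
        hWs.symm hV₀
      exact ⟨U, hU, hU₀⟩
  choose! V hV hV₀ using hA
  -- Each `V t` lives only on the segment from `t₀` to `t`; the global field takes its value at the
  -- end point. Near `t` uniqueness identifies these values with a single local parallel field.
  refine ⟨fun t ↦ V t t, fun t ht ↦ ?_, hV₀ t₀ ht₀⟩
  obtain ⟨ε, hε, hb⟩ := S.exists_ball_parallel (hγ t ht) (hvel t ht)
  obtain ⟨W, hW, hWt⟩ := hb t (Metric.mem_ball_self hε) (V t t)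
  obtain ⟨X, hX, hXW⟩ := hW t (Metric.mem_ball_self hε)
  rw [Metric.isOpen_ball.nhdsWithin_eq (Metric.mem_ball_self hε)] at hXW
  refine ⟨X, hX, ?_⟩
  filter_upwards [nhdsWithin_le_nhds (Metric.ball_mem_nhds t hε), self_mem_nhdsWithin,
    hXW.filter_mono nhdsWithin_le_nhds] with s hs hsI hsX
  refine ⟨hsX.1.trans ?_, hsX.2⟩
  obtain ⟨U, hU, hU₀, hUs⟩ := glue ht hsI (hV t ht) (hW.mono (hball hs)) hWt.symm (hV₀ t ht)
  rw [← hUs]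
  exact IsParallelAlong.eq_of_eq (fun r hr ↦ hγ r (hsub ht₀ hsI hr))
    (fun r hr ↦ hvel r (hsub ht₀ hsI hr)) ordConnected_uIcc hU (hV s hsI) left_mem_uIcc
    right_mem_uIcc (by rw [hU₀, hV₀ s hsI])

/-- The velocity of an autoparallel curve is parallel. -/
lemma IsTimelikeAutoparallel.contMDiffAt (h : S.IsTimelikeAutoparallel γ I) :
    ∀ t ∈ I, ∀ᶠ s in 𝓝 t, ContMDiffAt 𝓘(ℝ, ℝ) (𝓡 4) ∞ γ s := by
  obtain ⟨J, hJ, hIJ, hs⟩ := h.smooth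
  intro t ht
  filter_upwards [hJ.mem_nhds (hIJ ht)] with s hsJ
  exact hs.contMDiffAt (hJ.mem_nhds hsJ)

lemma IsTimelikeAutoparallel.velocity_ne_zero (h : S.IsTimelikeAutoparallel γ I) :
    ∀ t ∈ I, curveVelocity γ t ≠ 0 := fun t ht h0 ↦ by
  have := h.timelike t ht
  rw [h0, map_zero] at this
  exact this.ne rfl

/-- The autoparallel equation controls an extension `Z` of the velocity only in the direction of
`γ`. This suffices to make the inner products of `Z` with a local parallel frame constant, so the
velocity is a constant combination of frame fields, whose covariant derivatives vanish in all
directions. -/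
lemma IsTimelikeAutoparallel.isParallelAlong [T2Space M] (h : S.IsTimelikeAutoparallel γ I) :
    S.IsParallelAlong γ I (curveVelocity γ) := by
  intro t ht
  have hγ := h.contMDiffAt t ht
  have hvel := h.velocity_ne_zero t ht
  have hc : Tendsto γ (𝓝 t) (𝓝 (γ t)) := hγ.self_of_nhds.continuousAt
  obtain ⟨X, hX, hXD⟩ := S.exists_local_parallel_frame hγ hvel
  obtain ⟨Z, hZ, hZγ⟩ := exists_field_extending_velocity hγ hvel
  have hDZ : ∀ᶠ s in 𝓝[I] t, S.D Z (γ s) (curveVelocity γ s) = 0 := by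
    filter_upwards [hγ.filter_mono nhdsWithin_le_nhds,
      (hc.eventually hZ).filter_mono nhdsWithin_le_nhds,
      hZγ.eventually_nhds.filter_mono nhdsWithin_le_nhds, self_mem_nhdsWithin] with s h1 h2 h3 h4
    rw [← covDerivAlong_eq_of_eventuallyEq S.D (h1.mdifferentiableAt (by simp))
      (h2.mdifferentiableAt (by simp)) h3]
    exact h.autoparallel s h4
  have hconst : ∀ᶠ s in 𝓝[I] t, ∀ i, S.g.val (γ s) (Z (γ s)) (X i (γ s)) =
      S.g.val (γ t) (Z (γ t)) (X i (γ t)) := eventually_all.2 fun i ↦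
    eventually_metric_const (S := S) hγ h.ordConnected ht hZ (hX.mono fun x h ↦ h i) hDZ
      (hXD.filter_mono nhdsWithin_le_nhds |>.mono fun s h ↦ by rw [h.1]; rfl)
  refine ⟨fun x ↦ ∑ i, (minkowskiEta i i * S.g.val (γ t) (Z (γ t)) (X i (γ t))) • X i x,
    hX.mono fun x hx ↦ (parallel_frame_combination (S := S) hx _).1, ?_⟩
  filter_upwards [hconst, hXD.filter_mono nhdsWithin_le_nhds,
    hZγ.filter_mono nhdsWithin_le_nhds, (hc.eventually hX).filter_mono nhdsWithin_le_nhds]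
    with s h1 h2 h3 h4
  refine ⟨?_, (parallel_frame_combination h4 _).2 h2.1⟩
  rw [h3, S.g.eq_sum_of_orthonormal h2.2 (Z (γ s))]
  simp only [h1]

lemma IsParallelAlong.const_smul {V : ∀ t, TangentSpace (𝓡 4) (γ t)}
    (hγ : ∀ t ∈ K, ContinuousAt γ t)
    (hV : S.IsParallelAlong γ K V) (c : ℝ) : S.IsParallelAlong γ K fun t ↦ c • V t := fun t ht ↦ by
  obtain ⟨X, hX, hXV⟩ := hV t ht
  refine ⟨fun x ↦ c • X x, hX.mono fun x hx ↦ hx.const_smul_section, ?_⟩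
  filter_upwards [hXV, ((hγ t ht).tendsto.eventually hX).filter_mono nhdsWithin_le_nhds]
    with s hs hsX
  refine ⟨by rw [hs.1], ?_⟩
  have h1 := S.D.isCovariantDerivativeOnUniv.smul_const c (hsX.mdifferentiableAt (by simp))
    (mem_univ _)
  exact h1.trans (by rw [hs.2, smul_zero])

/-- A parallel orthonormal frame along a timelike autoparallel, starting with the unit tangent. -/
theorem IsTimelikeAutoparallel.exists_parallel_frame [T2Space M] (h : S.IsTimelikeAutoparallel γ I) :
    ∃ E : Fin 4 → ∀ t, TangentSpace (𝓡 4) (γ t), (∀ i, S.IsParallelAlong γ I (E i)) ∧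
      (∀ t ∈ I, E 0 t =
        (1 / √(S.g.val (γ t) (curveVelocity γ t) (curveVelocity γ t))) • curveVelocity γ t) ∧
      ∀ t ∈ I, ∀ i j, S.g.val (γ t) (E i t) (E j t) = minkowskiEta i j := by
  rcases I.eq_empty_or_nonempty with rfl | ⟨t₀, ht₀⟩
  · exact ⟨fun _ _ ↦ 0, fun _ _ ht ↦ ht.elim, fun _ ht ↦ ht.elim, fun _ ht ↦ ht.elim⟩
  let q : ℝ → ℝ := fun t ↦ S.g.val (γ t) (curveVelocity γ t) (curveVelocity γ t)
  have hq : ∀ t ∈ I, q t = q t₀ := fun t ht ↦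
    h.isParallelAlong.metric_const h.contMDiffAt h.ordConnected h.isParallelAlong ht ht₀
  have hq₀ : 0 < q t₀ := h.timelike t₀ ht₀
  have hunit : S.g.val (γ t₀) ((1 / √(q t₀)) • curveVelocity γ t₀)
      ((1 / √(q t₀)) • curveVelocity γ t₀) = 1 := by
    simp only [map_smul, smul_apply, smul_eq_mul]
    change 1 / √(q t₀) * (1 / √(q t₀) * q t₀) = 1
    have := Real.mul_self_sqrt hq₀.le
    have h2 := (Real.sqrt_pos.2 hq₀).ne'
    field_simp
    nlinarith
  obtain ⟨e, he₀, he⟩ := S.g.exists_orthonormal_of_unit _ hunit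
  choose V hV hVe using fun i ↦
    S.exists_parallel_transport h.ordConnected h.contMDiffAt h.velocity_ne_zero ht₀ (e i)
  refine ⟨V, hV, fun t ht ↦ ?_, fun t ht i j ↦ ?_⟩
  -- Since `q` is constant, the unit tangent is a constant multiple of the velocity, hence parallel,
  -- and uniqueness identifies it with `V 0`.
  · change V 0 t = (1 / √(q t)) • curveVelocity γ t
    rw [hq t ht]
    exact IsParallelAlong.eq_of_eq h.contMDiffAt h.velocity_ne_zero h.ordConnected (hV 0)
      (h.isParallelAlong.const_smul
        (fun t ht ↦ (h.contMDiffAt t ht).self_of_nhds.continuousAt) _) ht₀ ht (by rw [hVe, he₀])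
  · rw [(hV i).metric_const h.contMDiffAt h.ordConnected (hV j) ht ht₀, hVe, hVe, he]

end RiemannCartan

end ParallelTransport

/-! ### Gluing the local extensions by a partition of unity -/

section Gluing

open Filter Topology Set

variable {M : Type*} [TopologicalSpace M] [ChartedSpace R4 M] [IsManifold (𝓡 4) ∞ M]

/-- Smooth partitions of unity on an open subset of a manifold, as functions on the manifold. -/
lemma exists_partition_of_unity_on_iUnion [T2Space M] [SecondCountableTopology M]
    {ι : Type*} (U : ι → Set M) (hU : ∀ i, IsOpen (U i)) :
    ∃ ρ : ι → M → ℝ, (∀ i, ∀ x ∈ ⋃ i, U i, SmoothFunAt (ρ i) x) ∧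
      ∀ x ∈ ⋃ i, U i, ∃ F : Finset ι, (∀ i ∈ F, x ∈ U i) ∧
        ∀ᶠ y in 𝓝 x, ∑ i ∈ F, ρ i y = 1 ∧ ∀ i ∉ F, ρ i y = 0 := by
  classical
  let W : TopologicalSpace.Opens M := ⟨⋃ i, U i, isOpen_iUnion hU⟩
  have : LocallyCompactSpace M := ChartedSpace.locallyCompactSpace R4 M
  have : LocallyCompactSpace W := W.isOpen.locallyCompactSpace
  have hsub : (univ : Set W) ⊆ ⋃ i, ((↑) : W → M) ⁻¹' U i := fun x _ ↦ by
    obtain ⟨i, hi⟩ := mem_iUnion.1 (show (x : M) ∈ ⋃ i, U i from x.2)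
    exact mem_iUnion.2 ⟨i, hi⟩
  obtain ⟨f, hf⟩ := SmoothPartitionOfUnity.exists_isSubordinate (𝓡 4) (M := W) isClosed_univ
    (fun i ↦ ((↑) : W → M) ⁻¹' U i) (fun i ↦ (hU i).preimage continuous_subtype_val) hsub
  let ρ : ι → M → ℝ := fun i x ↦ if h : x ∈ W then f i ⟨x, h⟩ else 0
  have hρ : ∀ i (x : W), ρ i x = f i x := fun i x ↦ dif_pos x.2
  refine ⟨ρ, fun i x hx ↦ ?_, fun x hx ↦ ?_⟩
  · have h1 : ContMDiffAt (𝓡 4) 𝓘(ℝ, ℝ) ∞ (fun y : W ↦ ρ i y) ⟨x, hx⟩ := by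
      simp only [hρ]
      exact (f i).contMDiff _
    exact contMDiffAt_subtype_iff.1 h1
  -- The indices whose closed support contains `x`: all others vanish on a whole neighbourhood of
  -- `x`.
  · refine ⟨f.fintsupport ⟨x, hx⟩, fun i hi ↦ hf i ((f.mem_fintsupport_iff _ i).1 hi), ?_⟩
    have h1 := f.eventually_finsupport_subset ⟨x, hx⟩
    rw [← W.isOpen.nhdsWithin_eq hx]
    refine (eventually_nhds_subtype_iff (W : Set M) ⟨x, hx⟩ (fun y ↦ ∑ i ∈ f.fintsupport ⟨x, hx⟩,
      ρ i y = 1 ∧ ∀ i ∉ f.fintsupport ⟨x, hx⟩, ρ i y = 0)).1 (h1.mono fun y hy ↦ ?_)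
    simp only [hρ]
    refine ⟨f.sum_finsupport' y (mem_univ y) hy, fun i hi ↦ ?_⟩
    by_contra h
    exact hi (hy ((f.mem_finsupport y).2 h))

/-- On `γ` all local extensions take the same value `E` and have `D X = 0`, so `D (∑ ρ X) = (∑ dρ) ⊗
E`, which vanishes because `∑ ρ = 1`. -/
lemma RiemannCartan.exists_fields_extending [T2Space M] [SecondCountableTopology M]
    (S : RiemannCartan M) {γ : ℝ → M} {I : Set ℝ} {ι : Type*} [Finite ι]
    (hemb : IsEmbedding (fun t : I ↦ γ t)) {E : ι → ∀ t, TangentSpace (𝓡 4) (γ t)}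
    (hE : ∀ i, S.IsParallelAlong γ I (E i)) :
    ∃ (W : Set M) (f : ι → ∀ x : M, TangentSpace (𝓡 4) x), IsOpen W ∧ γ '' I ⊆ W ∧
      (∀ x ∈ W, ∀ i, FieldSmoothAt (f i) x) ∧
      ∀ t ∈ I, ∀ i, f i (γ t) = E i t ∧ S.D (f i) (γ t) = 0 := by
  classical
  choose X hX hXE using hE
  have hU : ∀ t : I, ∃ U : Set M, IsOpen U ∧ γ t ∈ U ∧
      (∀ x ∈ U, ∀ i, FieldSmoothAt (X i t t.2) x) ∧
      ∀ s : I, γ s ∈ U → ∀ i, X i t t.2 (γ s) = E i s ∧ S.D (X i t t.2) (γ s) = 0 := by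
    intro t
    have h1 : ∀ᶠ x in 𝓝 (γ t), ∀ i, FieldSmoothAt (X i t t.2) x :=
      eventually_all.2 fun i ↦ hX i t t.2
    have h2 : ∀ᶠ s in 𝓝[I] (t : ℝ), ∀ i,
        X i t t.2 (γ s) = E i s ∧ S.D (X i t t.2) (γ s) = 0 :=
      eventually_all.2 fun i ↦ hXE i t t.2
    have h3 := (eventually_nhds_subtype_iff I t _).2 h2
    -- Here the embedding is essential: a neighbourhood of `t` in `I` contains the preimage of a
    -- neighbourhood of `γ t` in `M`, so `γ` does not return close to `γ t` at remote parameters.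
    rw [hemb.isInducing.nhds_eq_comap, eventually_comap] at h3
    obtain ⟨U, hU, hUo, htU⟩ := eventually_nhds_iff.1 (h1.and h3)
    exact ⟨U, hUo, htU, fun x hx ↦ (hU x hx).1, fun s hs ↦ (hU _ hs).2 s rfl⟩
  choose U hUo htU hUX hUE using hU
  obtain ⟨ρ, hρ, hρ1⟩ := exists_partition_of_unity_on_iUnion U hUo
  have hloc : ∀ x ∈ ⋃ t, U t, ∃ F : Finset I, (∀ t ∈ F, x ∈ U t) ∧
      (∀ᶠ y in 𝓝 x, ∑ t ∈ F, ρ t y = 1) ∧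
      ∀ i, ∀ᶠ y in 𝓝 x, ∑ᶠ t, ρ t y • X i t t.2 y = ∑ t ∈ F, ρ t y • X i t t.2 y := by
    intro x hx
    obtain ⟨F, hF, h⟩ := hρ1 x hx
    refine ⟨F, hF, h.mono fun y hy ↦ hy.1, fun i ↦ h.mono fun y hy ↦ ?_⟩
    refine finsum_eq_sum_of_support_subset _ fun t ht ↦ ?_
    by_contra htF
    exact ht (by simp [hy.2 t htF])
  refine ⟨⋃ t, U t, fun i x ↦ ∑ᶠ t, ρ t x • X i t t.2 x, isOpen_iUnion hUo, ?_, ?_, ?_⟩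
  · rintro _ ⟨t, ht, rfl⟩
    exact mem_iUnion.2 ⟨⟨t, ht⟩, htU ⟨t, ht⟩⟩
  · intro x hx i
    obtain ⟨F, hF, -, h⟩ := hloc x hx
    have hs : FieldSmoothAt (fun y ↦ ∑ t ∈ F, ρ t y • X i t t.2 y) x :=
      ContMDiffAt.sum_section fun t ht ↦ (hρ t x hx).smul_section (hUX t x (hF t ht) i)
    exact hs.congr_of_eventuallyEq ((h i).mono fun y hy ↦ by simp only [hy])
  · intro s hs i
    have hx : γ s ∈ ⋃ t, U t := mem_iUnion.2 ⟨⟨s, hs⟩, htU ⟨s, hs⟩⟩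
    obtain ⟨F, hF, h1, h⟩ := hloc (γ s) hx
    have hsm : ∀ t ∈ F, FieldMDiffAt (X i t t.2) (γ s) := fun t ht ↦
      (hUX t _ (hF t ht) i).mdifferentiableAt (by simp)
    have hρd : ∀ t ∈ F, MDifferentiableAt (𝓡 4) 𝓘(ℝ, ℝ) (ρ t) (γ s) := fun t _ ↦
      (hρ t _ hx).mdifferentiableAt (by simp)
    have hval : ∀ t ∈ F, X i t t.2 (γ s) = E i s := fun t ht ↦ (hUE t ⟨s, hs⟩ (hF t ht) i).1
    have hD : ∀ t ∈ F, S.D (X i t t.2) (γ s) = 0 := fun t ht ↦ (hUE t ⟨s, hs⟩ (hF t ht) i).2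
    constructor
    · change ∑ᶠ t, ρ t (γ s) • X i t t.2 (γ s) = E i s
      rw [(h i).self_of_nhds, Finset.sum_congr rfl fun t ht ↦ by rw [hval t ht],
        ← Finset.sum_smul, h1.self_of_nhds, one_smul]
    · have hsum : FieldMDiffAt (fun y ↦ ∑ t ∈ F, ρ t y • X i t t.2 y) (γ s) :=
        MDifferentiableAt.sum_section fun t ht ↦ (hρd t ht).smul_section (hsm t ht)
      rw [← S.D.congr_of_eventuallyEq hsum ((h i).mono fun y hy ↦ hy.symm)]
      -- compare with `∑ ρ t • Y = Y` for the single field `Y`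
      let Y := X i s hs
      have hY : FieldMDiffAt Y (γ s) :=
        (hUX ⟨s, hs⟩ _ (htU ⟨s, hs⟩) i).mdifferentiableAt (by simp)
      obtain ⟨hYE, hYD⟩ := hUE ⟨s, hs⟩ ⟨s, hs⟩ (htU ⟨s, hs⟩) i
      ext1 v
      have e1 := S.D.sum_smul_apply F hρd (fun _ _ ↦ hY) v
      rw [← S.D.congr_of_eventuallyEq hY (h1.mono fun y hy ↦ by
        rw [← Finset.sum_smul, hy, one_smul])] at e1
      rw [S.D.sum_smul_apply F hρd hsm v, zero_apply]
      refine (Finset.sum_congr rfl fun t ht ↦ ?_).trans (e1.symm.trans ?_)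
      · rw [hval t ht, hD t ht, show Y (γ s) = E i s from hYE, show S.D Y (γ s) = 0 from hYD]
      · rw [show S.D Y (γ s) = 0 from hYD, zero_apply]

end Gluing

/-! ### Gram–Schmidt preserving vanishing covariant derivatives on the curve -/

section GramSchmidt

open Filter Topology Set

variable {M : Type*} [TopologicalSpace M] [ChartedSpace R4 M]

lemma HasMFDerivAt.comp_differentiableAt_of_zero {f : M → ℝ} {x : M}
    (hf : HasMFDerivAt (𝓡 4) 𝓘(ℝ, ℝ) f x 0) {φ : ℝ → ℝ} (hφ : DifferentiableAt ℝ φ (f x)) :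
    HasMFDerivAt (𝓡 4) 𝓘(ℝ, ℝ) (fun y ↦ φ (f y)) x 0 := by
  refine (hφ.hasFDerivAt.hasMFDerivAt.comp x hf).congr_mfderiv (ContinuousLinearMap.ext fun v ↦ ?_)
  exact map_zero (fderiv ℝ φ (f x))

lemma HasMFDerivAt.mul_of_zero {f h : M → ℝ} {x : M}
    (hf : HasMFDerivAt (𝓡 4) 𝓘(ℝ, ℝ) f x 0) (hh : HasMFDerivAt (𝓡 4) 𝓘(ℝ, ℝ) h x 0) :
    HasMFDerivAt (𝓡 4) 𝓘(ℝ, ℝ) (fun y ↦ f y * h y) x 0 := by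
  refine (hf.mul hh).congr_mfderiv (ContinuousLinearMap.ext fun v ↦ ?_)
  change f x * 0 + h x * 0 = 0
  simp

variable [IsManifold (𝓡 4) ∞ M]

namespace RiemannCartan

lemma hasMFDerivAt_metric_zero (S : RiemannCartan M) {X Y : ∀ x : M, TangentSpace (𝓡 4) x} {x : M}
    (hX : FieldSmoothAt X x) (hY : FieldSmoothAt Y x) (hDX : S.D X x = 0) (hDY : S.D Y x = 0) :
    HasMFDerivAt (𝓡 4) 𝓘(ℝ, ℝ) (fun y ↦ S.g.val y (X y) (Y y)) x 0 := by
  have h := ((S.contMDiffAt_metric hX hY).mdifferentiableAt (by simp)).hasMFDerivAt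
  convert h using 1
  ext v
  have := S.compatible X Y x (hX.mdifferentiableAt (by simp)) (hY.mdifferentiableAt (by simp)) v
  rw [hDX, hDY] at this
  simp only [zero_apply, map_zero, add_zero] at this
  exact this.symm

lemma D_smul_add_smul_eq_zero (S : RiemannCartan M) {X Y : ∀ x : M, TangentSpace (𝓡 4) x} {x : M}
    (hX : FieldMDiffAt X x) (hY : FieldMDiffAt Y x) (hDX : S.D X x = 0) (hDY : S.D Y x = 0)
    {p q : M → ℝ} (hp : HasMFDerivAt (𝓡 4) 𝓘(ℝ, ℝ) p x 0)
    (hq : HasMFDerivAt (𝓡 4) 𝓘(ℝ, ℝ) q x 0) :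
    S.D (fun y ↦ p y • X y + q y • Y y) x = 0 := by
  ext1 v
  have h := S.D.sum_smul_apply (x := x) Finset.univ (f := ![p, q]) (X := ![X, Y])
    (by simp [Fin.forall_fin_two, hp.mdifferentiableAt, hq.mdifferentiableAt])
    (by simp [Fin.forall_fin_two, hX, hY]) v
  have hp0 : mvfderiv (𝓡 4) p x = 0 := hp.mfderiv
  have hq0 : mvfderiv (𝓡 4) q x = 0 := hq.mfderiv
  simpa [Fin.sum_univ_two, hDX, hDY, hp0, hq0] using h

/-- The fields `f` near `C` are orthonormal and covariantly constant on `C`, and the first `n` of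
them are orthonormal, and orthogonal to the others, on all of `W`. -/
structure IsAdapted (S : RiemannCartan M) (C : Set M) (n : ℕ) (W : Set M)
    (f : Fin 4 → ∀ x : M, TangentSpace (𝓡 4) x) : Prop where
  isOpen : IsOpen W
  subset : C ⊆ W
  smooth : ∀ x ∈ W, ∀ i, FieldSmoothAt (f i) x
  D_eq_zero : ∀ x ∈ C, ∀ i, S.D (f i) x = 0
  orthonormal : ∀ x ∈ C, ∀ i j, S.g.val x (f i x) (f j x) = minkowskiEta i j
  orthonormal_lt : ∀ x ∈ W, ∀ i j : Fin 4, (i : ℕ) < n ∨ (j : ℕ) < n →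
    S.g.val x (f i x) (f j x) = minkowskiEta i j

/-- One Gram–Schmidt step: `f k` is normalised and its component is removed from the other fields.
The coefficients are smooth functions of Gram matrix entries, whose differential vanishes on `C` by
compatibility, so `D = 0` survives there; on `C` the step changes no value. -/
lemma IsAdapted.exists_succ {S : RiemannCartan M} {C W : Set M} {k : Fin 4}
    {f : Fin 4 → ∀ x : M, TangentSpace (𝓡 4) x} (h : S.IsAdapted C k W f) :
    ∃ W' f', S.IsAdapted C (k + 1) W' f' ∧ ∀ x ∈ C, ∀ i, f' i x = f i x := by
  set η := minkowskiEta k k with hη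
  have hηη : η * η = 1 := minkowskiEta_mul_self k
  let G : Fin 4 → M → ℝ := fun i x ↦ S.g.val x (f i x) (f k x)
  have hG : ∀ x ∈ W, ∀ i, SmoothFunAt (G i) x := fun x hx i ↦
    S.contMDiffAt_metric (h.smooth x hx i) (h.smooth x hx k)
  have hG0 : ∀ x ∈ C, ∀ i, HasMFDerivAt (𝓡 4) 𝓘(ℝ, ℝ) (G i) x 0 := fun x hx i ↦
    S.hasMFDerivAt_metric_zero (h.smooth x (h.subset hx) i) (h.smooth x (h.subset hx) k)
      (h.D_eq_zero x hx i) (h.D_eq_zero x hx k)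
  have hGC : ∀ x ∈ C, ∀ i, G i x = minkowskiEta i k := fun x hx i ↦ h.orthonormal x hx i k
  -- Where `g (f k, f k)` has the sign of `η_kk`, so that the square root and the inverses are
  -- smooth.
  let W' : Set M := W ∩ {x | 0 < η * G k x}
  have hW' : IsOpen W' := by
    refine ContinuousOn.isOpen_inter_preimage (f := fun x ↦ η * G k x) (t := Ioi 0)
      (fun x hx ↦ ?_) h.isOpen isOpen_Ioi
    exact (continuousAt_const.mul (hG x hx k).continuousAt).continuousWithinAt
  -- Both cases take the form `p f_i + q f_k`. For `i ≠ k`, `q = -G_i / G_k` is the projection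
  -- coefficient, with `η` inserted in numerator and denominator.
  let p : Fin 4 → ℝ := fun i ↦ if i = k then 0 else 1
  let q : Fin 4 → M → ℝ := fun i x ↦
    if i = k then (√(η * G k x))⁻¹ else -η * G i x * (η * G k x)⁻¹
  let f' : Fin 4 → ∀ x : M, TangentSpace (𝓡 4) x := fun i x ↦ p i • f i x + q i x • f k x
  have hCW : C ⊆ W' := fun x hx ↦ ⟨h.subset hx, by
    change 0 < η * G k x
    rw [hGC x hx k, ← hη, hηη]; exact one_pos⟩
  have hf'C : ∀ x ∈ C, ∀ i, f' i x = f i x := by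
    intro x hx i
    by_cases hi : i = k
    · subst hi
      simp [f', p, q, hGC x hx, ← hη, hηη]
    · simp [f', p, q, hGC x hx, hi, minkowskiEta_ne i k hi]
  refine ⟨W', f', ⟨hW', hCW, ?_, ?_, ?_, ?_⟩, hf'C⟩
  · rintro x ⟨hx, hpos : 0 < η * G k x⟩ i
    have hα : SmoothFunAt (fun y ↦ η * G k y) x := contMDiffAt_const.mul (hG x hx k)
    have hq : SmoothFunAt (q i) x := by
      by_cases hi : i = k
      · simp only [q, hi, if_true]
        exact ((Real.contDiffAt_sqrt hpos.ne').inv (Real.sqrt_pos.2 hpos).ne').contMDiffAt.comp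
          (g := fun r : ℝ ↦ (√r)⁻¹) x hα
      · simp only [q, hi, if_false]
        exact (contMDiffAt_const.mul (hG x hx i)).mul
          ((contDiffAt_inv ℝ hpos.ne').contMDiffAt.comp (g := fun r : ℝ ↦ r⁻¹) x hα)
    exact ((h.smooth x hx i).const_smul_section (a := p i)).add_section
      (hq.smul_section (h.smooth x hx k))
  · intro x hx i
    have hpos : 0 < η * G k x := (hCW hx).2
    have hα : HasMFDerivAt (𝓡 4) 𝓘(ℝ, ℝ) (fun y ↦ η * G k y) x 0 :=
      (hG0 x hx k).comp_differentiableAt_of_zero (φ := fun r ↦ η * r) (by fun_prop)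
    have hq : HasMFDerivAt (𝓡 4) 𝓘(ℝ, ℝ) (q i) x 0 := by
      by_cases hi : i = k
      · rw [show q i = fun y ↦ (√(η * G k y))⁻¹ from funext fun y ↦ if_pos hi]
        exact hα.comp_differentiableAt_of_zero (φ := fun r ↦ (√r)⁻¹)
          ((Real.contDiffAt_sqrt (n := 1) hpos.ne').inv
            (Real.sqrt_pos.2 hpos).ne').differentiableAt_one
      · rw [show q i = fun y ↦ -η * G i y * (η * G k y)⁻¹ from funext fun y ↦ if_neg hi]
        exact ((hG0 x hx i).comp_differentiableAt_of_zero (φ := fun r ↦ -η * r)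
          (by fun_prop)).mul_of_zero (hα.comp_differentiableAt_of_zero (φ := fun r ↦ r⁻¹)
          (differentiableAt_inv hpos.ne'))
    have hW := h.subset hx
    exact S.D_smul_add_smul_eq_zero (p := fun _ ↦ p i)
      ((h.smooth x hW i).mdifferentiableAt (by simp))
      ((h.smooth x hW k).mdifferentiableAt (by simp)) (h.D_eq_zero x hx i) (h.D_eq_zero x hx k)
      (hasMFDerivAt_const _ _) hq
  · intro x hx i j
    rw [hf'C x hx, hf'C x hx, h.orthonormal x hx]
  · rintro x ⟨hx, hpos : 0 < η * G k x⟩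
    have hexp : ∀ i j, S.g.val x (f' i x) (f' j x) =
        p i * p j * S.g.val x (f i x) (f j x) + p i * q j x * G i x + q i x * p j * G j x +
          q i x * q j x * G k x := by
      intro i j
      simp only [f', map_add, map_smul, add_apply, smul_apply, smul_eq_mul, G,
        S.g.symm x (f k x) (f j x)]
      ring
    have hsym : ∀ i j, S.g.val x (f' i x) (f' j x) = minkowskiEta i j →
        S.g.val x (f' j x) (f' i x) = minkowskiEta j i := fun i j hij ↦ by
      rw [S.g.symm, hij]
      by_cases hij' : i = j
      · rw [hij']
      · rw [minkowskiEta_ne i j hij', minkowskiEta_ne j i (Ne.symm hij')]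
    have hmain : ∀ i j : Fin 4, (i : ℕ) < k + 1 → S.g.val x (f' i x) (f' j x) = minkowskiEta i j := by
      intro i j hik
      rw [hexp]
      by_cases hi : i = k
      · subst hi
        by_cases hj : j = i
        · subst hj
          have hs : √(η * G j x) * √(η * G j x) = η * G j x := Real.mul_self_sqrt hpos.le
          have hs0 : √(η * G j x) ≠ 0 := (Real.sqrt_pos.2 hpos).ne'
          simp only [p, q, if_true]
          rw [← hη]
          field_simp
          rw [sq, hs]
          linear_combination (-G j x) * hηη
        · have hG0 : G i x ≠ 0 := fun h0 ↦ by simp [h0] at hpos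
          have hη0 : η ≠ 0 := fun h0 ↦ by simp [h0] at hpos
          simp only [p, q, if_true, hj, if_false]
          rw [minkowskiEta_ne i j (Ne.symm hj)]
          field_simp
          ring
      -- Fields treated earlier are already orthogonal to `f k` on `W`, so this step leaves them
      -- unchanged.
      · have hik' : (i : ℕ) < k := by
          have : (i : ℕ) ≠ k := fun h ↦ hi (Fin.ext h)
          omega
        have hGi : G i x = 0 := by
          rw [← minkowskiEta_ne i k hi]
          exact h.orthonormal_lt x hx i k (Or.inl hik')
        have hqi : q i x = 0 := by simp [q, hi, hGi]
        by_cases hj : j = k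
        · subst hj
          simp [hqi, hGi, p, minkowskiEta_ne i j hi]
        · simp [hqi, hGi, p, hi, hj, h.orthonormal_lt x hx i j (Or.inl hik')]
    rintro i j (hi | hj)
    · exact hmain i j hi
    · exact hsym j i (hmain j i hj)

lemma IsAdapted.exists_orthonormal {S : RiemannCartan M} {C W : Set M}
    {f : Fin 4 → ∀ x : M, TangentSpace (𝓡 4) x} (h : S.IsAdapted C 0 W f) :
    ∃ W' f', S.IsAdapted C 4 W' f' ∧ ∀ x ∈ C, ∀ i, f' i x = f i x := by
  have key : ∀ n ≤ 4, ∃ W' f', S.IsAdapted C n W' f' ∧ ∀ x ∈ C, ∀ i, f' i x = f i x := by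
    intro n
    induction n with
    | zero => exact fun _ ↦ ⟨W, f, h, fun _ _ _ ↦ rfl⟩
    | succ n ih =>
      intro hn
      obtain ⟨W₁, f₁, h₁, hf₁⟩ := ih (by omega)
      obtain ⟨W₂, f₂, h₂, hf₂⟩ := IsAdapted.exists_succ (k := ⟨n, hn⟩) h₁
      exact ⟨W₂, f₂, h₂, fun x hx i ↦ (hf₂ x hx i).trans (hf₁ x hx i)⟩
  exact key 4 le_rfl

end RiemannCartan

end GramSchmidt

/-! ### Existence of the inertial moving frame -/

section InertialFrame

open Filter Topology Set

variable {M : Type*} [TopologicalSpace M] [ChartedSpace R4 M] [IsManifold (𝓡 4) ∞ M]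

namespace RiemannCartan

lemma IsAdapted.isOrthonormalFrameOn {S : RiemannCartan M} {C W : Set M}
    {f : Fin 4 → ∀ x : M, TangentSpace (𝓡 4) x} (h : S.IsAdapted C 4 W f) :
    S.IsOrthonormalFrameOn W f := by
  have ho : ∀ x ∈ W, ∀ i j, S.g.val x (f i x) (f j x) = minkowskiEta i j := fun x hx i j ↦
    h.orthonormal_lt x hx i j (Or.inl i.2)
  exact
  { isOpen := h.isOpen
    frame :=
      { linearIndependent := fun hx ↦ S.g.linearIndependent_of_orthonormal (ho _ hx)
        generating := fun hx ↦ S.g.span_eq_top_of_orthonormal (ho _ hx)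
        contMDiffOn := fun i x hx ↦ (h.smooth x hx i).contMDiffWithinAt }
    orthonormal := ho }

theorem IsTimelikeAutoparallel.exists_isInertialMovingFrame [T2Space M] [SecondCountableTopology M]
    {S : RiemannCartan M} {γ : ℝ → M} {I : Set ℝ} (h : S.IsTimelikeAutoparallel γ I)
    (hemb : IsEmbedding (fun t : I ↦ γ t)) :
    ∃ U e, S.IsInertialMovingFrame γ I U e := by
  obtain ⟨E, hE, hE0, hEo⟩ := h.exists_parallel_frame
  obtain ⟨W, f, hW, hsub, hf, hfE⟩ := S.exists_fields_extending hemb hE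
  have h0 : S.IsAdapted (γ '' I) 0 W f :=
    { isOpen := hW
      subset := hsub
      smooth := hf
      D_eq_zero := by
        rintro _ ⟨t, ht, rfl⟩ i
        exact (hfE t ht i).2
      orthonormal := by
        rintro _ ⟨t, ht, rfl⟩ i j
        rw [(hfE t ht i).1, (hfE t ht j).1, hEo t ht]
      orthonormal_lt := fun x hx i j hij ↦ by simp at hij }
  obtain ⟨U, e, he, hef⟩ := h0.exists_orthonormal
  refine ⟨U, e, he.isOrthonormalFrameOn, he.subset, fun t ht ↦ ?_, fun t ht μ ν ρ ↦ ?_⟩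
  · rw [hef _ (mem_image_of_mem γ ht), (hfE t ht 0).1, hE0 t ht]
  · simp only [IsOrthonormalFrameOn.connectionCoeff]
    rw [he.D_eq_zero _ (mem_image_of_mem γ ht), zero_apply, map_zero]

end RiemannCartan

end InertialFrame

/-! ### Structure coefficients, torsion and coordinate bases -/

section StructureCoefficients

open Filter Topology Set

variable {M : Type*} [TopologicalSpace M] [ChartedSpace R4 M]

lemma isInvertible_mfderiv_of_mem_maximalAtlas {n : ℕ∞ω} (hn : n ≠ 0)
    {φ : OpenPartialHomeomorph M R4} (hφ : φ ∈ IsManifold.maximalAtlas (𝓡 4) n M) {x : M}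
    (hx : x ∈ φ.source) : (mfderiv (𝓡 4) (𝓡 4) φ x).IsInvertible := by
  let Φ : PartialDiffeomorph (𝓡 4) (𝓡 4) M R4 n :=
    { toPartialEquiv := φ.toPartialEquiv
      open_source := φ.open_source
      open_target := φ.open_target
      contMDiffOn_toFun := contMDiffOn_of_mem_maximalAtlas hφ
      contMDiffOn_invFun := contMDiffOn_symm_of_mem_maximalAtlas hφ }
  have h : IsLocalDiffeomorphAt (𝓡 4) (𝓡 4) n φ x := ⟨Φ, hx, fun _ _ ↦ rfl⟩
  exact ⟨h.mfderivToContinuousLinearEquiv hn, rfl⟩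

variable [IsManifold (𝓡 4) ∞ M]

/-- Coordinate vector fields commute. -/
lemma IsCoordinateBasisNear.mlieBracket_eq_zero {e : Fin 4 → ∀ x : M, TangentSpace (𝓡 4) x} {x : M}
    (h : IsCoordinateBasisNear e x) (μ ν : Fin 4) :
    VectorField.mlieBracket (𝓡 4) (e μ) (e ν) x = 0 := by
  obtain ⟨φ, hφ, hx, he⟩ := h
  have hc : ContMDiffAt (𝓡 4) (𝓡 4) ∞ φ x :=
    contMDiffAt_of_mem_maximalAtlas hφ hx
  have hsm : ContMDiffAt (𝓡 4) (𝓡 4) 2 φ x := hc.of_le ENat.LEInfty.out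
  let K : Fin 4 → ∀ y : R4, TangentSpace (𝓡 4) y := fun i _ ↦ (EuclideanSpace.single i (1 : ℝ) : R4)
  have hK : ∀ i (y : R4), FieldMDiffAt (K i) y := fun i y ↦
    (contMDiffAt_vectorSpace_iff_contDiffAt (n := 1).2 contDiffAt_const).mdifferentiableAt (by simp)
  -- Near `x` the field `e i` is the pullback under `φ` of a constant field; constant fields
  -- commute, and pullback respects the bracket.
  have hpull : ∀ i, ∀ᶠ y in 𝓝 x, VectorField.mpullback (𝓡 4) (𝓡 4) φ (K i) y = e i y := by
    intro i
    filter_upwards [φ.open_source.mem_nhds hx] with y hy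
    have h1 := isInvertible_mfderiv_of_mem_maximalAtlas (n := ∞) (by simp) hφ hy
    rw [VectorField.mpullback_apply, show K i (φ y) = _ from (he y hy i).symm]
    exact h1.inverse_apply_eq.2 rfl
  have hbr : VectorField.mlieBracket (𝓡 4) (K μ) (K ν) (φ x) = 0 := by
    rw [← VectorField.mlieBracketWithin_univ, VectorField.mlieBracketWithin_eq_lieBracketWithin]
    simp [VectorField.lieBracketWithin, K]
    rfl
  have hM : IsManifold (𝓡 4) (minSmoothness ℝ 2) M := by
    rw [minSmoothness_of_isRCLikeNormedField]
    infer_instance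
  have := VectorField.mpullback_mlieBracket (n := 2) (hK μ (φ x)) (hK ν (φ x)) hsm (by simp)
  rw [← Filter.EventuallyEq.mlieBracket_vectorField_eq (hpull μ) (hpull ν), ← this]
  simp [VectorField.mpullback, hbr]

namespace RiemannCartan

variable {S : RiemannCartan M} {U : Set M} {e : Fin 4 → ∀ x : M, TangentSpace (𝓡 4) x}

lemma IsOrthonormalFrameOn.fieldSmoothAt (h : S.IsOrthonormalFrameOn U e) {x : M} (hx : x ∈ U)
    (i : Fin 4) : FieldSmoothAt (e i) x :=
  h.frame.contMDiffAt h.isOpen hx i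

lemma IsOrthonormalFrameOn.eq_sum_coeff (h : S.IsOrthonormalFrameOn U e) {x : M} (hx : x ∈ U)
    (v : TangentSpace (𝓡 4) x) : v = ∑ i, h.frame.coeff i x v • e i x := by
  classical
  simpa using h.frame.coeff_sum_eq (Function.update 0 x v) hx

lemma IsOrthonormalFrameOn.torsion_eq_zero_iff (h : S.IsOrthonormalFrameOn U e) {x : M}
    (hx : x ∈ U) : S.D.torsion x = 0 ↔ ∀ β μ ν, h.torsionCoeff β μ ν x = 0 := by
  constructor
  · intro h0 β μ ν
    simp [torsionCoeff, h0]
  · intro h0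
    have h1 : ∀ μ ν, S.D.torsion x (e μ x) (e ν x) = 0 := fun μ ν ↦ by
      rw [h.eq_sum_coeff hx (S.D.torsion x (e μ x) (e ν x))]
      exact Finset.sum_eq_zero fun β _ ↦ by
        rw [show h.frame.coeff β x (S.D.torsion x (e μ x) (e ν x)) = 0 from h0 β μ ν, zero_smul]
    ext1 v
    ext1 w
    rw [h.eq_sum_coeff hx v, h.eq_sum_coeff hx w]
    simp only [map_sum, map_smul, sum_apply, smul_apply, h1, smul_zero, Finset.sum_const_zero,
      zero_apply]

/-- With both covariant derivatives zero at `x`, the torsion formula reduces to `T(e_μ, e_ν) =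
-[e_μ, e_ν]`. -/
lemma IsOrthonormalFrameOn.structureCoeff_eq_neg_torsionCoeff (h : S.IsOrthonormalFrameOn U e)
    {x : M} (hx : x ∈ U) (h0 : ∀ μ ν ρ, h.connectionCoeff μ ν ρ x = 0) (β μ ν : Fin 4) :
    h.structureCoeff β μ ν x = -h.torsionCoeff β μ ν x := by
  have hD : ∀ ν ρ, S.D (e ρ) x (e ν x) = 0 := fun ν ρ ↦ by
    rw [h.eq_sum_coeff hx (S.D (e ρ) x (e ν x))]
    exact Finset.sum_eq_zero fun μ _ ↦ by
      rw [show h.frame.coeff μ x (S.D (e ρ) x (e ν x)) = 0 from h0 μ ν ρ, zero_smul]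
  have ht := S.D.torsion_apply ((h.fieldSmoothAt hx μ).mdifferentiableAt (by simp))
    ((h.fieldSmoothAt hx ν).mdifferentiableAt (by simp))
  rw [hD, hD, sub_zero, zero_sub] at ht
  rw [structureCoeff, torsionCoeff, ht, map_neg, neg_neg]

end RiemannCartan

end StructureCoefficients

/-! ### The theorem -/

theorem mainTheorem1 {M : Type*} [TopologicalSpace M] [T2Space M] [SecondCountableTopology M]
    [ChartedSpace R4 M] [IsManifold (𝓡 4) ∞ M]
    (S : RiemannCartan M) (γ : ℝ → M) (I : Set ℝ)
    (hγ : S.IsTimelikeAutoparallel γ I)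
    (hemb : Topology.IsEmbedding (fun t : I ↦ γ t)) :
    (∃ (U : Set M) (e : Fin 4 → ∀ x : M, TangentSpace (𝓡 4) x),
      S.IsInertialMovingFrame γ I U e) ∧
    ∀ (U : Set M) (e : Fin 4 → ∀ x : M, TangentSpace (𝓡 4) x)
      (h : S.IsInertialMovingFrame γ I U e),
      (∀ x ∈ U, ∀ μ ν, VectorField.mlieBracket (𝓡 4) (e μ) (e ν) x =
        ∑ β, h.isOrthonormalFrameOn.structureCoeff β μ ν x • e β x) ∧
      ∀ t ∈ I,
        (∀ β μ ν, h.isOrthonormalFrameOn.structureCoeff β μ ν (γ t) =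
          -h.isOrthonormalFrameOn.torsionCoeff β μ ν (γ t)) ∧
        ((∃ β μ ν, h.isOrthonormalFrameOn.structureCoeff β μ ν (γ t) ≠ 0) ↔
          S.D.torsion (γ t) ≠ 0) ∧
        (S.D.torsion (γ t) ≠ 0 → ¬ IsCoordinateBasisNear e (γ t)) := by
  refine ⟨hγ.exists_isInertialMovingFrame hemb, fun U e h ↦
    ⟨fun x hx μ ν ↦ h.isOrthonormalFrameOn.eq_sum_coeff hx _, fun t ht ↦ ?_⟩⟩
  have hx : γ t ∈ U := h.subset (Set.mem_image_of_mem γ ht)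
  have hc := h.isOrthonormalFrameOn.structureCoeff_eq_neg_torsionCoeff hx
    (h.connectionCoeff_eq_zero t ht)
  have hiff : (∃ β μ ν, h.isOrthonormalFrameOn.structureCoeff β μ ν (γ t) ≠ 0) ↔
      S.D.torsion (γ t) ≠ 0 := by
    rw [ne_eq, h.isOrthonormalFrameOn.torsion_eq_zero_iff hx]
    simp only [hc, ne_eq, neg_eq_zero, not_forall]
  refine ⟨hc, hiff, fun hT hcoord ↦ ?_⟩
  obtain ⟨β, μ, ν, hne⟩ := hiff.2 hT
  apply hne
  rw [RiemannCartan.IsOrthonormalFrameOn.structureCoeff, hcoord.mlieBracket_eq_zero, map_zero]
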